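/- Let $\mathcal G=(\mathcal G^1,\mathcal G^0,r,s)$ be a finite directed graph without loops or multiple edges, with edge set $\mathcal G^1$, vertex set $\mathcal G^0$, and range and source maps $r,s$. Let $\mathrm C(\mathcal G^1)$ be the $\mathrm C^*$-correspondence over $\mathrm C(\mathcal G^0)$ given by $(\xi\cdot f)(e)=\xi(e)f(r(e))$, $\langle\xi,\eta\rangle(v)=\sum_{r(e)=v}\overline{\xi(e)}\eta(e)$ and $(\phi(f)\xi)(e)=f(s(e))\xi(e)$. A compact quantum group $G$ is a unital $\mathrm C^*$-algebra $\mathrm C(G)\neq 0$ with a coassociative unital $*$-homomorphism $\Delta_G:\mathrm C(G)\to\mathrm C(G)\otimes\mathrm C(G)$ (minimal tensor product) such that $\Delta_G(\mathrm C(G))(1\otimes\mathrm C(G))$ and $\Delta_G(\mathrm C(G))(\mathrm C(G)\otimes1)$ span dense subspaces. A morphism $G_1\to G_2$ is a unital $*$-homomorphism $f:\mathrm C(G_2)\to\mathrm C(G_1)$ with $(f\otimes f)\Delta_{G_2}=\Delta_{G_1}f$. A $G$-$\mathrm C^*$-algebra is a unital $\mathrm C^*$-algebra $A$ with a unital $*$-homomorphism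 $\alpha:A\to A\otimes\mathrm C(G)$ such that $(\alpha\otimes\mathrm{id})\alpha=(\mathrm{id}\otimes\Delta_G)\alpha$ and $\alpha(A)(1\otimes\mathrm C(G))$ spans a dense subspace of $A\otimes \mathrm C(G)$. The action $\alpha$ is faithful if the $*$-algebra generated by $\{(\omega\otimes\mathrm{id})\alpha(a):a\in A,\ \omega\in A^*\}$ is dense in $\mathrm C(G)$. The objects of the category $\mathcal C_{\mathrm{Bic}}(\mathcal G)$ are the triples $(G,\alpha,\lambda)$ of a compact quantum group $G$, a unital $*$-homomorphism $\alpha:\mathrm C(\mathcal G^0)\to\mathrm C(\mathcal G^0)\otimes\mathrm C(G)$ and a linear map $\lambda:\mathrm C(\mathcal G^1)\to\mathrm C(\mathcal G^1)\otimes\mathrm C(G)$ such that (i) $(\mathrm C(\mathcal G^0),\alpha)$ is a $G$-$\mathrm C^*$-algebra and $\alpha$ is faithful; (ii) $(\mathrm C(\mathcal G^1),\phi,\lambda)$ is a $G$-equivariant $\mathrm C^*$-correspondence over $(\mathrm C(\mathcal G^0),\alpha)$: $\lambda(\xi\cdot f)=\lambda(\xi)\cdot\alpha(f)$, $\langle\lambda(\xi),\lambda(\eta)\rangle=\alpha(\langle\xi,\eta\rangle)$,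 $\lambda(\phi(f)\xi)=(\phi\otimes\mathrm{id})(\alpha(f))\lambda(\xi)$, $(\lambda\otimes\mathrm{id})\lambda=(\mathrm{id}\otimes\Delta_G)\lambda$, and $\lambda(\mathrm C(\mathcal G^1))(1\otimes\mathrm C(G))$ spans a dense subspace of $\mathrm C(\mathcal G^1)\otimes\mathrm C(G)$; (iii) $\lambda$ also makes the $\mathrm C^*$-algebra $\mathrm C(\mathcal G^1)$ a $G$-$\mathrm C^*$-algebra. A morphism $(G_1,\alpha_1,\lambda_1)\to(G_2,\alpha_2,\lambda_2)$ is a morphism $f:\mathrm C(G_2)\to\mathrm C(G_1)$ of compact quantum groups $G_1\to G_2$ with $(\mathrm{id}\otimes f)\alpha_2=\alpha_1$ and $(\mathrm{id}\otimes f)\lambda_2=\lambda_1$. Bichon's quantum automorphism group $\mathrm{Aut}^+_{\mathrm{Bic}}(\mathcal G)$ is the compact quantum group whose $\mathrm C^*$-algebra is the universal unital $\mathrm C^*$-algebra generated by elements $q_{vw}$, $v,w\in\mathcal G^0$, with the relations $$q_{vw}^*=q_{vw},\quad q_{vw}q_{vu}=\delta_{wu}q_{vw},\quad q_{vw}q_{uw}=\delta_{vu}q_{vw},\quad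 \sum_{w}q_{vw}=\sum_{w}q_{wv}=1,$$ $$q_{s(e)v}q_{r(e)w}=q_{r(e)w}q_{s(e)v}=0,\quad q_{vs(e)}q_{wr(e)}=q_{wr(e)}q_{vs(e)}=0$$ for $e\in\mathcal G^1$ whenever there is no edge from $v$ to $w$, and $q_{s(e)s(f)}q_{r(e)r(f)}=q_{r(e)r(f)}q_{s(e)s(f)}$ for $e,f\in\mathcal G^1$, and whose comultiplication is $\Delta(q_{vw})=\sum_{u}q_{vu}\otimes q_{uw}$. Theorem. The compact quantum group $\mathrm{Aut}^+_{\mathrm{Bic}}(\mathcal G)$ exists. The category $\mathcal C_{\mathrm{Bic}}(\mathcal G)$ has a universal (terminal) object $(G_{\mathrm{Bic}},\alpha_{\mathrm{Bic}},\lambda_{\mathrm{Bic}})$: every object has exactly one morphism to it. Moreover, $G_{\mathrm{Bic}}$ is isomorphic, as a compact quantum group, to $\mathrm{Aut}^+_{\mathrm{Bic}}(\mathcal G)$. -/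

import Mathlib

open scoped TensorProduct ENNReal
open CategoryTheory

universe u v w

noncomputable section

/-! ### Hilbert space tensor product -/

/-- The Hilbert space tensor product of two Hilbert spaces: the completion of the algebraic tensor
product for the inner product `⟪x ⊗ y, x' ⊗ y'⟫ = ⟪x, x'⟫ ⟪y, y'⟫`. -/
def HilbertTensor (H K : Type u) [NormedAddCommGroup H] [InnerProductSpace ℂ H]
    [NormedAddCommGroup K] [InnerProductSpace ℂ K] : Type u :=
  UniformSpace.Completion (H ⊗[ℂ] K)

namespace HilbertTensor

variable {H K : Type u} [NormedAddCommGroup H] [InnerProductSpace ℂ H]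
    [NormedAddCommGroup K] [InnerProductSpace ℂ K]

instance : NormedAddCommGroup (HilbertTensor H K) :=
  inferInstanceAs (NormedAddCommGroup (UniformSpace.Completion (H ⊗[ℂ] K)))

instance : InnerProductSpace ℂ (HilbertTensor H K) :=
  inferInstanceAs (InnerProductSpace ℂ (UniformSpace.Completion (H ⊗[ℂ] K)))

instance : CompleteSpace (HilbertTensor H K) :=
  inferInstanceAs (CompleteSpace (UniformSpace.Completion (H ⊗[ℂ] K)))

variable (H K) in
/-- The inclusion of the algebraic tensor product. -/
def coe : H ⊗[ℂ] K →ₗᵢ[ℂ] HilbertTensor H K := UniformSpace.Completion.toComplₗᵢ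

theorem denseRange_coe : DenseRange (coe H K) := UniformSpace.Completion.denseRange_coe

instance [Nontrivial H] [Nontrivial K] : Nontrivial (HilbertTensor H K) := by
  obtain ⟨x, hx⟩ := exists_ne (0 : H)
  obtain ⟨y, hy⟩ := exists_ne (0 : K)
  refine ⟨⟨coe H K (x ⊗ₜ[ℂ] y), 0, fun h => ?_⟩⟩
  have h' := congrArg norm h
  rw [(coe H K).norm_map, TensorProduct.norm_tmul, norm_zero] at h'
  simp [hx, hy] at h'

/-- The operator `S ⊗ T` on the Hilbert space tensor product. -/
def op (S : H →L[ℂ] H) (T : K →L[ℂ] K) : HilbertTensor H K →L[ℂ] HilbertTensor H K :=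
  (TensorProduct.mapL S T).completion

theorem op_coe (S : H →L[ℂ] H) (T : K →L[ℂ] K) (z : H ⊗[ℂ] K) :
    op S T (coe H K z) = coe H K (TensorProduct.mapL S T z) :=
  ContinuousLinearMap.completion_apply_coe _ _

theorem op_ext {S T : HilbertTensor H K →L[ℂ] HilbertTensor H K}
    (h : ∀ z, S (coe H K z) = T (coe H K z)) : S = T :=
  ContinuousLinearMap.ext fun c =>
    denseRange_coe.induction_on c (isClosed_eq S.continuous T.continuous) h

theorem norm_op_le (S : H →L[ℂ] H) (T : K →L[ℂ] K) : ‖op S T‖ ≤ ‖S‖ * ‖T‖ := by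
  refine ContinuousLinearMap.opNorm_le_bound _ (by positivity) fun c => ?_
  refine denseRange_coe.induction_on c
    (isClosed_le (op S T).continuous.norm (continuous_const.mul continuous_norm)) fun z => ?_
  rw [op_coe, (coe H K).norm_map, (coe H K).norm_map]
  exact (ContinuousLinearMap.le_opNorm _ _).trans
    (mul_le_mul_of_nonneg_right (TensorProduct.norm_mapL_le _ _) (norm_nonneg _))

theorem op_add_left (S S' : H →L[ℂ] H) (T : K →L[ℂ] K) : op (S + S') T = op S T + op S' T :=
  op_ext fun z => by simp [op_coe, TensorProduct.mapL_add_left]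

theorem op_smul_left (c : ℂ) (S : H →L[ℂ] H) (T : K →L[ℂ] K) : op (c • S) T = c • op S T :=
  op_ext fun z => by simp [op_coe, TensorProduct.mapL_smul_left]

theorem op_add_right (S : H →L[ℂ] H) (T T' : K →L[ℂ] K) : op S (T + T') = op S T + op S T' :=
  op_ext fun z => by simp [op_coe, TensorProduct.mapL_add_right]

theorem op_smul_right (c : ℂ) (S : H →L[ℂ] H) (T : K →L[ℂ] K) : op S (c • T) = c • op S T :=
  op_ext fun z => by simp [op_coe, TensorProduct.mapL_smul_right]

theorem op_mul (S S' : H →L[ℂ] H) (T T' : K →L[ℂ] K) :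
    op (S * S') (T * T') = op S T * op S' T' :=
  op_ext fun z => by
    rw [mul_apply_eq_comp, op_coe, op_coe, op_coe, TensorProduct.mapL_mul]
    rfl

theorem op_one : op (1 : H →L[ℂ] H) (1 : K →L[ℂ] K) = 1 :=
  op_ext fun z => by
    rw [op_coe]
    exact congrArg _ (DFunLike.congr_fun TensorProduct.mapL_id_id z)

theorem op_star [CompleteSpace H] [CompleteSpace K] (S : H →L[ℂ] H) (T : K →L[ℂ] K) :
    op (star S) (star T) = star (op S T) := by
  refine (ContinuousLinearMap.eq_adjoint_iff _ _).mpr fun x y => ?_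
  refine denseRange_coe.induction_on₂ (isClosed_eq
    (((op (star S) (star T)).continuous.comp continuous_fst).inner continuous_snd)
    (continuous_fst.inner ((op S T).continuous.comp continuous_snd))) (fun x y => ?_) x y
  rw [op_coe, op_coe, (coe H K).inner_map_map, (coe H K).inner_map_map]
  induction x using TensorProduct.induction_on with
  | zero => simp
  | add x x' hx hx' => simp only [map_add, inner_add_left, hx, hx']
  | tmul a b =>
    induction y using TensorProduct.induction_on with
    | zero => simp
    | add y y' hy hy' => simp only [map_add, inner_add_right, hy, hy']
    | tmul c d =>
      rw [TensorProduct.mapL_tmul, TensorProduct.mapL_tmul, TensorProduct.inner_tmul,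
        TensorProduct.inner_tmul, ContinuousLinearMap.star_eq_adjoint,
        ContinuousLinearMap.star_eq_adjoint, ContinuousLinearMap.adjoint_inner_left,
        ContinuousLinearMap.adjoint_inner_left]

/-- `(S, T) ↦ S ⊗ T` as a bilinear map. -/
def opBilin : (H →L[ℂ] H) →ₗ[ℂ] (K →L[ℂ] K) →ₗ[ℂ] (HilbertTensor H K →L[ℂ] HilbertTensor H K) :=
  LinearMap.mk₂ ℂ op op_add_left op_smul_left op_add_right op_smul_right

end HilbertTensor

/-! ### Representations on Hilbert spaces -/

/-- A unital `*`-representation of a unital `*`-algebra on a nonzero Hilbert space. -/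
structure HilbertRep (X : Type u) [Ring X] [StarRing X] [Algebra ℂ X] : Type (u + 1) where
  H : Type u
  [normed : NormedAddCommGroup H]
  [inner : InnerProductSpace ℂ H]
  [complete : CompleteSpace H]
  [nontrivial : Nontrivial H]
  hom : X →⋆ₐ[ℂ] (H →L[ℂ] H)

namespace HilbertRep

attribute [instance] normed inner complete nontrivial

/-- The representation `π ∘ f`. -/
def comp {X Y : Type u} [Ring X] [StarRing X] [Algebra ℂ X] [Ring Y] [StarRing Y] [Algebra ℂ Y]
    (π : HilbertRep Y) (f : X →⋆ₐ[ℂ] Y) : HilbertRep X where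
  H := π.H
  hom := π.hom.comp f

variable {A B : Type u} [CStarAlgebra A] [CStarAlgebra B]

/-- The linear map underlying `π ⊗ ρ`. -/
def tensorLin (π : HilbertRep A) (ρ : HilbertRep B) :
    A ⊗[ℂ] B →ₗ[ℂ] (HilbertTensor π.H ρ.H →L[ℂ] HilbertTensor π.H ρ.H) :=
  TensorProduct.lift (HilbertTensor.opBilin.compl₁₂
    (π.hom.toAlgHom.toLinearMap) (ρ.hom.toAlgHom.toLinearMap))

theorem tensorLin_tmul (π : HilbertRep A) (ρ : HilbertRep B) (a : A) (b : B) :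
    tensorLin π ρ (a ⊗ₜ b) = HilbertTensor.op (π.hom a) (ρ.hom b) := rfl

theorem tensorLin_star (π : HilbertRep A) (ρ : HilbertRep B) (x : A ⊗[ℂ] B) :
    tensorLin π ρ (star x) = star (tensorLin π ρ x) := by
  induction x using TensorProduct.induction_on with
  | zero => rw [star_zero, map_zero, star_zero]
  | add x y hx hy => rw [star_add, map_add, map_add, star_add, hx, hy]
  | tmul a b =>
    rw [TensorProduct.star_tmul, tensorLin_tmul, tensorLin_tmul, map_star, map_star,
      HilbertTensor.op_star]

/-- The tensor product representation `π ⊗ ρ` of the algebraic tensor product, on the Hilbert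
space tensor product: `(π ⊗ ρ)(a ⊗ b) = π(a) ⊗ ρ(b)`. -/
def tensor (π : HilbertRep A) (ρ : HilbertRep B) : HilbertRep (A ⊗[ℂ] B) where
  H := HilbertTensor π.H ρ.H
  hom :=
    { Algebra.TensorProduct.algHomOfLinearMapTensorProduct (tensorLin π ρ)
        (fun a a' b b' => by
          rw [tensorLin_tmul, tensorLin_tmul, tensorLin_tmul, map_mul, map_mul,
            HilbertTensor.op_mul])
        (by rw [tensorLin_tmul, map_one, map_one, HilbertTensor.op_one]) with
      map_star' := tensorLin_star π ρ }

theorem tensor_hom_tmul (π : HilbertRep A) (ρ : HilbertRep B) (a : A) (b : B) :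
    (tensor π ρ).hom (a ⊗ₜ[ℂ] b) = HilbertTensor.op (π.hom a) (ρ.hom b) := rfl

theorem norm_hom_le (π : HilbertRep A) (a : A) : ‖π.hom a‖ ≤ ‖a‖ :=
  NonUnitalStarAlgHom.norm_apply_le π.hom a

end HilbertRep

/-! ### The minimal tensor product -/

namespace MinTensor

variable (A B : Type u) [CStarAlgebra A] [CStarAlgebra B]

/-- All functions of the form `x ↦ ‖(π ⊗ ρ)(x)‖` on the algebraic tensor product, `π` and `ρ`
representations of `A` and `B`. (A small set indexing, up to equality of norms, all pairs of
representations.) -/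
def Index : Type u :=
  {p : A ⊗[ℂ] B → ℝ // ∃ (π : HilbertRep A) (ρ : HilbertRep B),
    ∀ x, p x = ‖(π.tensor ρ).hom x‖}

variable {A B}

theorem Index.exists_rep (i : Index A B) : ∃ σ : HilbertRep (A ⊗[ℂ] B),
    (∃ (π : HilbertRep A) (ρ : HilbertRep B), σ = π.tensor ρ) ∧ ∀ x, ‖σ.hom x‖ = i.1 x := by
  obtain ⟨p, π, ρ, h⟩ := i
  exact ⟨π.tensor ρ, ⟨π, ρ, rfl⟩, fun x => (h x).symm⟩

/-- A product representation with norm function `i`. -/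
@[irreducible] def Index.rep (i : Index A B) : HilbertRep (A ⊗[ℂ] B) := i.exists_rep.choose

theorem Index.rep_eq (i : Index A B) :
    ∃ (π : HilbertRep A) (ρ : HilbertRep B), i.rep = π.tensor ρ := by
  rw [Index.rep]; exact i.exists_rep.choose_spec.1

theorem Index.norm_rep (i : Index A B) (x : A ⊗[ℂ] B) : ‖i.rep.hom x‖ = i.1 x := by
  rw [Index.rep]; exact i.exists_rep.choose_spec.2 x

theorem exists_bound (x : A ⊗[ℂ] B) : ∃ C : ℝ, 0 ≤ C ∧
    ∀ (π : HilbertRep A) (ρ : HilbertRep B), ‖(π.tensor ρ).hom x‖ ≤ C := by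
  induction x using TensorProduct.induction_on with
  | zero => exact ⟨0, le_rfl, fun π ρ => by rw [map_zero, norm_zero]⟩
  | add x y hx hy =>
    obtain ⟨C, hC, hx⟩ := hx
    obtain ⟨D, hD, hy⟩ := hy
    exact ⟨C + D, by positivity, fun π ρ => by
      rw [map_add]; exact (norm_add_le _ _).trans (add_le_add (hx π ρ) (hy π ρ))⟩
  | tmul a b =>
    refine ⟨‖a‖ * ‖b‖, by positivity, fun π ρ => ?_⟩
    rw [HilbertRep.tensor_hom_tmul]
    refine (HilbertTensor.norm_op_le _ _).trans ?_
    exact mul_le_mul (π.norm_hom_le a) (ρ.norm_hom_le b) (norm_nonneg _) (norm_nonneg _)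

theorem memℓp (x : A ⊗[ℂ] B) :
    Memℓp (E := fun i : Index A B => i.rep.H →L[ℂ] i.rep.H) (fun i => i.rep.hom x) ∞ := by
  obtain ⟨C, -, hC⟩ := exists_bound x
  refine memℓp_infty ⟨C, ?_⟩
  rintro _ ⟨i, rfl⟩
  obtain ⟨π, ρ, h⟩ := i.2
  have := hC π ρ
  rw [← h x, ← i.norm_rep x] at this
  exact this

variable (A B)

/-- The C*-algebra of bounded families of operators, one for each product representation. -/
def Ambient : Type u := lp (fun i : Index A B => i.rep.H →L[ℂ] i.rep.H) ∞

instance instAmbient : CStarAlgebra (Ambient A B) :=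
  { (inferInstance : NonUnitalCStarAlgebra (lp (fun i : Index A B => i.rep.H →L[ℂ] i.rep.H) ∞)),
    (inferInstance : NormedAlgebra ℂ (lp (fun i : Index A B => i.rep.H →L[ℂ] i.rep.H) ∞)),
    (inferInstance : NormedRing (lp (fun i : Index A B => i.rep.H →L[ℂ] i.rep.H) ∞)) with }

theorem Ambient.ext {x y : Ambient A B} (h : ∀ i, x.1 i = y.1 i) : x = y :=
  Subtype.ext (funext h)

/-- The `*`-homomorphism from the algebraic tensor product sending `x` to the family of all
`(π ⊗ ρ)(x)`. -/
def incl : A ⊗[ℂ] B →⋆ₐ[ℂ] Ambient A B where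
  toFun x := ⟨fun i => i.rep.hom x, memℓp x⟩
  map_one' := Ambient.ext _ _ fun i => map_one i.rep.hom
  map_mul' x y := Ambient.ext _ _ fun i => map_mul i.rep.hom x y
  map_zero' := Ambient.ext _ _ fun i => map_zero i.rep.hom
  map_add' x y := Ambient.ext _ _ fun i => map_add i.rep.hom x y
  commutes' c := Ambient.ext _ _ fun i => AlgHomClass.commutes i.rep.hom c
  map_star' x := Ambient.ext _ _ fun i => map_star i.rep.hom x

/-- The closure of the image of the algebraic tensor product. -/
def subalgebra : StarSubalgebra ℂ (Ambient A B) := (incl A B).range.topologicalClosure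

instance : IsClosed (subalgebra A B : Set (Ambient A B)) :=
  StarSubalgebra.isClosed_topologicalClosure _

end MinTensor

/-- The minimal (spatial) tensor product of two unital C*-algebras: the completion of the algebraic
tensor product for the norm `‖x‖ = sup ‖(π ⊗ ρ)(x)‖`, the supremum over all representations `π`
and `ρ` of the factors on Hilbert spaces. -/
def MinTensor (A B : Type u) [CStarAlgebra A] [CStarAlgebra B] : Type u :=
  MinTensor.subalgebra A B

namespace MinTensor

section

variable (A B : Type u) [CStarAlgebra A] [CStarAlgebra B]

instance : CStarAlgebra (MinTensor A B) :=
  StarSubalgebra.cstarAlgebra (subalgebra A B)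

/-- The canonical map of the algebraic tensor product into the minimal tensor product. -/
def of : A ⊗[ℂ] B →⋆ₐ[ℂ] MinTensor A B :=
  (incl A B).codRestrict (subalgebra A B)
    fun x => StarSubalgebra.le_topologicalClosure _ ⟨x, rfl⟩

variable {A B}

/-- The elementary tensor `a ⊗ b`. -/
def tmul (a : A) (b : B) : MinTensor A B := of A B (a ⊗ₜ[ℂ] b)

theorem denseRange_of : DenseRange (of A B) := by
  intro x
  have hx : (Subtype.val : subalgebra A B → Ambient A B) x ∈ closure (Set.range (incl A B)) := x.2
  refine (closure_subtype (s := Set.range (of A B))).mpr (closure_mono ?_ hx)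
  rintro _ ⟨y, rfl⟩
  exact ⟨of A B y, ⟨y, rfl⟩, rfl⟩

theorem norm_of_eq (x : A ⊗[ℂ] B) : ‖of A B x‖ = ‖incl A B x‖ := rfl

theorem norm_tensor_le (π : HilbertRep A) (ρ : HilbertRep B) (x : A ⊗[ℂ] B) :
    ‖(π.tensor ρ).hom x‖ ≤ ‖of A B x‖ := by
  let i : Index A B := ⟨fun x => ‖(π.tensor ρ).hom x‖, π, ρ, fun _ => rfl⟩
  have h := lp.norm_apply_le_norm (E := fun i : Index A B => i.rep.H →L[ℂ] i.rep.H)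
    ENNReal.top_ne_zero (incl A B x) i
  rw [norm_of_eq]
  exact (i.norm_rep x).symm.le.trans h

theorem norm_of_le (x : A ⊗[ℂ] B) {C : ℝ} (hC : 0 ≤ C)
    (h : ∀ (π : HilbertRep A) (ρ : HilbertRep B), ‖(π.tensor ρ).hom x‖ ≤ C) :
    ‖of A B x‖ ≤ C := by
  rw [norm_of_eq]
  refine lp.norm_le_of_forall_le (E := fun i : Index A B => i.rep.H →L[ℂ] i.rep.H) hC fun i => ?_
  obtain ⟨π, ρ, hi⟩ := i.2
  have := h π ρ
  rw [← hi x, ← i.norm_rep x] at this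
  exact this

theorem hom_ext {C : Type*} [CStarAlgebra C] {f g : MinTensor A B →⋆ₐ[ℂ] C}
    (h : ∀ a b, f (tmul a b) = g (tmul a b)) : f = g := by
  have hf : Continuous f := AddMonoidHomClass.continuous_of_bound f 1 fun x => by
    rw [one_mul]; exact NonUnitalStarAlgHom.norm_apply_le f x
  have hg : Continuous g := AddMonoidHomClass.continuous_of_bound g 1 fun x => by
    rw [one_mul]; exact NonUnitalStarAlgHom.norm_apply_le g x
  refine DFunLike.ext _ _ fun x => denseRange_of.induction_on x (isClosed_eq hf hg) fun y => ?_
  induction y using TensorProduct.induction_on with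
  | zero => rw [map_zero, map_zero, map_zero]
  | add y z hy hz => rw [map_add, map_add, map_add, hy, hz]
  | tmul a b => exact h a b

section extend

variable {C : Type*} [CStarAlgebra C] (f : A ⊗[ℂ] B →⋆ₐ[ℂ] C)

/-- The continuous linear extension of a bounded homomorphism. -/
def extendL : MinTensor A B →L[ℂ] C :=
  f.toAlgHom.toLinearMap.extendOfNorm (of A B).toAlgHom.toLinearMap

theorem extendL_of (hf : ∀ x, ‖f x‖ ≤ ‖of A B x‖) (x : A ⊗[ℂ] B) : extendL f (of A B x) = f x :=
  LinearMap.extendOfNorm_eq (f := f.toAlgHom.toLinearMap) (e := (of A B).toAlgHom.toLinearMap)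
    denseRange_of ⟨1, fun x => by rw [one_mul]; exact hf x⟩ x

theorem extendL_mul (hf : ∀ x, ‖f x‖ ≤ ‖of A B x‖) (x y : MinTensor A B) :
    extendL f (x * y) = extendL f x * extendL f y := by
  have h₁ : Continuous fun p : MinTensor A B × MinTensor A B => extendL f (p.1 * p.2) :=
    (extendL f).continuous.comp continuous_mul
  have h₂ : Continuous fun p : MinTensor A B × MinTensor A B => extendL f p.1 * extendL f p.2 :=
    ((extendL f).continuous.comp continuous_fst).mul ((extendL f).continuous.comp continuous_snd)
  have h₃ : IsClosed {p : MinTensor A B × MinTensor A B |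
      extendL f (p.1 * p.2) = extendL f p.1 * extendL f p.2} := isClosed_eq h₁ h₂
  refine denseRange_of.induction_on₂ (p := fun x y =>
    extendL f (x * y) = extendL f x * extendL f y) h₃ (fun x y => ?_) x y
  rw [← map_mul, extendL_of f hf, extendL_of f hf, extendL_of f hf, map_mul]

/-- The extension of a `*`-homomorphism from the algebraic tensor product that is contractive for
the minimal norm. -/
def extend (hf : ∀ x, ‖f x‖ ≤ ‖of A B x‖) : MinTensor A B →⋆ₐ[ℂ] C where
  toFun := extendL f
  map_one' := by rw [← map_one (of A B), extendL_of f hf, map_one]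
  map_zero' := map_zero _
  map_add' := map_add _
  map_mul' := extendL_mul f hf
  commutes' c := by
    rw [Algebra.algebraMap_eq_smul_one, Algebra.algebraMap_eq_smul_one, map_smul,
      ← map_one (of A B), extendL_of f hf, map_one]
  map_star' x := by
    refine denseRange_of.induction_on x (isClosed_eq
      ((extendL f).continuous.comp continuous_star)
      (continuous_star.comp (extendL f).continuous)) (fun x => ?_)
    rw [← map_star, extendL_of f hf, extendL_of f hf, map_star]

theorem extend_of (hf : ∀ x, ‖f x‖ ≤ ‖of A B x‖) (x : A ⊗[ℂ] B) :
    extend f hf (of A B x) = f x := extendL_of f hf x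

end extend

end

section map

variable {A B A' B' : Type u} [CStarAlgebra A] [CStarAlgebra B] [CStarAlgebra A'] [CStarAlgebra B']

/-- `f ⊗ g` on algebraic tensor products. -/
def algMap (f : A →⋆ₐ[ℂ] A') (g : B →⋆ₐ[ℂ] B') : A ⊗[ℂ] B →⋆ₐ[ℂ] A' ⊗[ℂ] B' :=
  { Algebra.TensorProduct.map f.toAlgHom g.toAlgHom with
    map_star' := fun x => by
      show Algebra.TensorProduct.map f.toAlgHom g.toAlgHom (star x)
        = star (Algebra.TensorProduct.map f.toAlgHom g.toAlgHom x)
      induction x using TensorProduct.induction_on with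
      | zero => rw [star_zero, map_zero, star_zero]
      | add x y hx hy => rw [star_add, map_add, map_add, star_add, hx, hy]
      | tmul a b =>
        rw [TensorProduct.star_tmul, Algebra.TensorProduct.map_tmul,
          Algebra.TensorProduct.map_tmul, TensorProduct.star_tmul]
        exact congrArg₂ _ (map_star f a) (map_star g b) }

theorem algMap_tmul (f : A →⋆ₐ[ℂ] A') (g : B →⋆ₐ[ℂ] B') (a : A) (b : B) :
    algMap f g (a ⊗ₜ[ℂ] b) = f a ⊗ₜ[ℂ] g b := rfl

theorem tensor_comp_hom (π : HilbertRep A') (ρ : HilbertRep B') (f : A →⋆ₐ[ℂ] A')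
    (g : B →⋆ₐ[ℂ] B') (x : A ⊗[ℂ] B) :
    ((π.comp f).tensor (ρ.comp g)).hom x = (π.tensor ρ).hom (algMap f g x) := by
  induction x using TensorProduct.induction_on with
  | zero => rw [map_zero, map_zero, map_zero]; rfl
  | add x y hx hy => rw [map_add, map_add, map_add, hx, hy]; rfl
  | tmul a b => rfl

/-- The `*`-homomorphism `f ⊗ g` of minimal tensor products. -/
def map (f : A →⋆ₐ[ℂ] A') (g : B →⋆ₐ[ℂ] B') : MinTensor A B →⋆ₐ[ℂ] MinTensor A' B' :=
  extend ((of A' B').comp (algMap f g)) fun x =>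
    norm_of_le (algMap f g x) (norm_nonneg _) fun π ρ => by
      rw [← tensor_comp_hom]
      exact norm_tensor_le _ _ x

@[simp] theorem map_tmul (f : A →⋆ₐ[ℂ] A') (g : B →⋆ₐ[ℂ] B') (a : A) (b : B) :
    map f g (tmul a b) = tmul (f a) (g b) := extend_of _ _ _

theorem map_id : map (StarAlgHom.id ℂ A) (StarAlgHom.id ℂ B) = StarAlgHom.id ℂ (MinTensor A B) :=
  hom_ext fun a b => map_tmul _ _ a b

theorem map_comp {A'' B'' : Type u} [CStarAlgebra A''] [CStarAlgebra B'']
    (f' : A' →⋆ₐ[ℂ] A'') (g' : B' →⋆ₐ[ℂ] B'') (f : A →⋆ₐ[ℂ] A') (g : B →⋆ₐ[ℂ] B') :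
    map (f'.comp f) (g'.comp g) = (map f' g').comp (map f g) :=
  hom_ext fun a b => by
    rw [map_tmul, StarAlgHom.comp_apply (map f' g'), map_tmul, map_tmul]; rfl

end map

end MinTensor

/-- `y ∈ (A ⊗ B) ⊗ C` and `x ∈ A ⊗ (B ⊗ C)` are the same element of the threefold minimal tensor
product `A ⊗ B ⊗ C`: the pair `(y, x)` lies in the graph of the canonical isomorphism
`(A ⊗ B) ⊗ C ≅ A ⊗ (B ⊗ C)`. That graph is the closure of the graph of the associativity map of the
algebraic tensor products, i.e. of the set of the pairs
`(∑ᵢ (aᵢ ⊗ bᵢ) ⊗ cᵢ, ∑ᵢ aᵢ ⊗ (bᵢ ⊗ cᵢ))`, the sums being finite. -/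
def MinTensor.AssocEq {A B C : Type u} [CStarAlgebra A] [CStarAlgebra B] [CStarAlgebra C]
    (y : MinTensor (MinTensor A B) C) (x : MinTensor A (MinTensor B C)) : Prop :=
  (y, x) ∈ closure ((Submodule.span ℂ
    {p | ∃ (a : A) (b : B) (c : C), p = (tmul (tmul a b) c, tmul a (tmul b c))} :
      Submodule ℂ (MinTensor (MinTensor A B) C × MinTensor A (MinTensor B C))) :
        Set (MinTensor (MinTensor A B) C × MinTensor A (MinTensor B C)))

/-! ### Compact quantum groups -/

/-- A compact quantum group `G`: a unital C*-algebra `C(G)` with a unital `*`-homomorphism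
`Δ : C(G) → C(G) ⊗ C(G)` that is coassociative and bisimplifiable. -/
structure CompactQuantumGroup : Type (u + 1) where
  /-- The C*-algebra `C(G)`. -/
  C : Type u
  [cstarAlgebra : CStarAlgebra C]
  [nontrivial : Nontrivial C]
  /-- The comultiplication. -/
  Δ : C →⋆ₐ[ℂ] MinTensor C C
  coassoc : ∀ a, MinTensor.AssocEq (MinTensor.map Δ (StarAlgHom.id ℂ C) (Δ a))
    (MinTensor.map (StarAlgHom.id ℂ C) Δ (Δ a))
  /-- `[Δ(C(G))(1 ⊗ C(G))] = C(G) ⊗ C(G)`. -/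
  dense_right : Dense (Submodule.span ℂ {x | ∃ a b : C, x = Δ a * MinTensor.tmul 1 b} :
    Set (MinTensor C C))
  /-- `[Δ(C(G))(C(G) ⊗ 1)] = C(G) ⊗ C(G)`. -/
  dense_left : Dense (Submodule.span ℂ {x | ∃ a b : C, x = Δ a * MinTensor.tmul b 1} :
    Set (MinTensor C C))

namespace CompactQuantumGroup

attribute [instance] cstarAlgebra nontrivial

/-- A morphism `G₁ → G₂` of compact quantum groups: a Hopf `*`-homomorphism `C(G₂) → C(G₁)`. -/
@[ext] structure Hom (G₁ G₂ : CompactQuantumGroup.{u}) : Type u where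
  hom : G₂.C →⋆ₐ[ℂ] G₁.C
  comul_hom : ∀ a, MinTensor.map hom hom (G₂.Δ a) = G₁.Δ (hom a)

instance : Category.{u} CompactQuantumGroup.{u} where
  Hom := Hom
  id G := ⟨StarAlgHom.id ℂ G.C, fun a => by rw [MinTensor.map_id]; rfl⟩
  comp f g := ⟨f.hom.comp g.hom, fun a => by
    rw [MinTensor.map_comp, StarAlgHom.comp_apply, g.comul_hom, f.comul_hom]; rfl⟩

end CompactQuantumGroup

/-! ### Actions on finite spaces

For a finite set `X`, `C(X)` is `X → ℂ`, and for a C*-algebra `B` the tensor product `C(X) ⊗ B` is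
`X → B` with the supremum norm, the elementary tensor `f ⊗ b` being `x ↦ f(x) b`. -/

namespace FinSpace

variable {X : Type*} [Fintype X]

/-- The elementary tensor `f ⊗ b ∈ C(X) ⊗ B`. -/
def tmul {B : Type u} [CStarAlgebra B] (f : X → ℂ) (b : B) : X → B := fun x => f x • b

/-- `id ⊗ g : C(X) ⊗ B → C(X) ⊗ D`. -/
def idTensor {B D : Type u} [CStarAlgebra B] [CStarAlgebra D] (g : B →⋆ₐ[ℂ] D) (F : X → B) :
    X → D :=
  fun x => g (F x)

/-- `ω ⊗ id : C(X) ⊗ B → B` for a functional `ω` on `C(X)`. -/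
def slice [DecidableEq X] {B : Type u} [CStarAlgebra B] (ω : (X → ℂ) →L[ℂ] ℂ) (F : X → B) : B :=
  ∑ x, ω (Pi.single x 1) • F x

/-- `α ⊗ id : C(X) ⊗ B → C(X) ⊗ A ⊗ B` for a linear map `α : C(X) → C(X) ⊗ A`; it sends
`F = ∑ₓ δₓ ⊗ F(x)` to `∑ₓ α(δₓ) ⊗ F(x)`. -/
def tensorId [DecidableEq X] {A B : Type u} [CStarAlgebra A] [CStarAlgebra B]
    (α : (X → ℂ) →ₗ[ℂ] (X → A)) (F : X → B) : X → MinTensor A B :=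
  fun y => ∑ x, MinTensor.tmul (α (Pi.single x 1) y) (F x)

/-- The linear map `α` satisfies `(α ⊗ id) ∘ α = (id ⊗ Δ) ∘ α`. -/
def Coassociative [DecidableEq X] (G : CompactQuantumGroup.{u})
    (α : (X → ℂ) →ₗ[ℂ] (X → G.C)) : Prop :=
  ∀ f, tensorId α (α f) = idTensor G.Δ (α f)

/-- The Podleś condition: the closed linear span of the `α(f)(1 ⊗ c)` is `C(X) ⊗ C(G)`. -/
def Podles (G : CompactQuantumGroup.{u}) (α : (X → ℂ) →ₗ[ℂ] (X → G.C)) : Prop :=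
  Dense (Submodule.span ℂ {F : X → G.C | ∃ (f : X → ℂ) (c : G.C), F = α f * tmul 1 c} :
    Set (X → G.C))

/-- `(C(X), α)` is a `G`-C*-algebra. -/
structure IsAction [DecidableEq X] (G : CompactQuantumGroup.{u})
    (α : (X → ℂ) →⋆ₐ[ℂ] (X → G.C)) : Prop where
  coassoc : Coassociative G α.toAlgHom.toLinearMap
  podles : Podles G α.toAlgHom.toLinearMap

/-- The action `α` is faithful: the `*`-algebra generated by the `(ω ⊗ id)(α(f))` is dense in
`C(G)`. -/
def IsFaithful [DecidableEq X] (G : CompactQuantumGroup.{u})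
    (α : (X → ℂ) →⋆ₐ[ℂ] (X → G.C)) : Prop :=
  Dense (StarAlgebra.adjoin ℂ {c : G.C | ∃ (ω : (X → ℂ) →L[ℂ] ℂ) (f : X → ℂ),
    c = slice ω (α f)} : Set G.C)

end FinSpace

/-! ### Directed graphs and their C*-correspondences -/

/-- A directed graph with vertex set `V`, edge set `E`, range map `r` and source map `s`. -/
structure DirectedGraph (V : Type v) (E : Type w) where
  r : E → V
  s : E → V

namespace DirectedGraph

variable {V : Type v} {E : Type w} (𝒢 : DirectedGraph V E)

/-- There are no loops and no multiple edges. -/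
structure IsSimple : Prop where
  no_loops : ∀ e, 𝒢.s e ≠ 𝒢.r e
  no_multiple_edges : ∀ e f, 𝒢.s e = 𝒢.s f → 𝒢.r e = 𝒢.r f → e = f

/-- There is an edge from `v` to `w`. -/
def IsEdge (v w : V) : Prop := ∃ e, 𝒢.s e = v ∧ 𝒢.r e = w

section correspondence

variable {B : Type u} [CStarAlgebra B]

/-- The right action of `C(V) ⊗ B` on `C(E) ⊗ B`. For `B = ℂ` this is the right action of `C(V)` on
the correspondence `C(E)`, namely `(ξ · f)(e) = ξ(e) f(r(e))`; for general `B` it is the action on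
the exterior tensor product, `(ξ ⊗ b) · (f ⊗ c) = (ξ · f) ⊗ bc`. -/
def rightAct (ξ : E → B) (f : V → B) : E → B := fun e => ξ e * f (𝒢.r e)

/-- The left action of `C(V) ⊗ B` on `C(E) ⊗ B`. For `B = ℂ` this is the homomorphism `φ` of the
correspondence, `(φ(f) ξ)(e) = f(s(e)) ξ(e)`; for general `B` it is `φ ⊗ id`, with
`(φ ⊗ id)(f ⊗ c) (ξ ⊗ b) = φ(f) ξ ⊗ cb`. -/
def leftAct (f : V → B) (ξ : E → B) : E → B := fun e => f (𝒢.s e) * ξ e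

/-- The `C(V) ⊗ B`-valued inner product on `C(E) ⊗ B`. For `B = ℂ` this is the inner product of the
correspondence, `⟨ξ, η⟩(v) = ∑_{r(e) = v} conj (ξ(e)) η(e)`; for general `B` it is the one of the
exterior tensor product, `⟨ξ ⊗ b, η ⊗ c⟩ = ⟨ξ, η⟩ ⊗ b* c`. -/
def innerProd [Fintype E] [DecidableEq V] (ξ η : E → B) : V → B :=
  fun v => ∑ e with 𝒢.r e = v, star (ξ e) * η e

end correspondence

variable [Fintype V] [DecidableEq V] [Fintype E] [DecidableEq E]

/-- `(C(E), φ, λ)` is a `G`-equivariant C*-correspondence over `(C(V), α)`. -/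
structure IsEquivariant (G : CompactQuantumGroup.{u}) (α : (V → ℂ) →⋆ₐ[ℂ] (V → G.C))
    (lam : (E → ℂ) →ₗ[ℂ] (E → G.C)) : Prop where
  map_rightAct : ∀ ξ f, lam (𝒢.rightAct ξ f) = 𝒢.rightAct (lam ξ) (α f)
  innerProd_map : ∀ ξ η, 𝒢.innerProd (lam ξ) (lam η) = α (𝒢.innerProd ξ η)
  coassoc : FinSpace.Coassociative G lam
  podles : Dense (Submodule.span ℂ {F : E → G.C | ∃ (ξ : E → ℂ) (c : G.C),
    F = 𝒢.rightAct (lam ξ) (FinSpace.tmul 1 c)} : Set (E → G.C))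
  map_leftAct : ∀ f ξ, lam (𝒢.leftAct f ξ) = 𝒢.leftAct (α f) (lam ξ)

/-- An object `(G, α, λ)` of the category `C_Bic(𝒢)`. -/
structure BicObj : Type (max (u + 1) v w) where
  G : CompactQuantumGroup.{u}
  α : (V → ℂ) →⋆ₐ[ℂ] (V → G.C)
  lam : (E → ℂ) →ₗ[ℂ] (E → G.C)
  /-- `(C(V), α)` is a `G`-C*-algebra. -/
  isAction : FinSpace.IsAction G α
  isFaithful : FinSpace.IsFaithful G α
  isEquivariant : 𝒢.IsEquivariant G α lam
  /-- `(C(E), λ)` is a `G`-C*-algebra. -/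
  isAction_lam : ∃ L : (E → ℂ) →⋆ₐ[ℂ] (E → G.C), (∀ ξ, L ξ = lam ξ) ∧ FinSpace.IsAction G L

namespace BicObj

variable {𝒢}

/-- A morphism `(G₁, α₁, λ₁) → (G₂, α₂, λ₂)` of `C_Bic(𝒢)`: a Hopf `*`-homomorphism
`f : C(G₂) → C(G₁)` with `(id ⊗ f) α₂ = α₁` and `(id ⊗ f) λ₂ = λ₁`. -/
@[ext] structure Hom (X₁ X₂ : BicObj.{u} 𝒢) where
  f : X₁.G ⟶ X₂.G
  map_α : ∀ a, FinSpace.idTensor f.hom (X₂.α a) = X₁.α a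
  map_lam : ∀ ξ, FinSpace.idTensor f.hom (X₂.lam ξ) = X₁.lam ξ

instance : Category (BicObj.{u} 𝒢) where
  Hom := Hom
  id X := ⟨𝟙 X.G, fun _ => rfl, fun _ => rfl⟩
  comp F F' := ⟨F.f ≫ F'.f,
    fun a => by rw [← F.map_α, ← F'.map_α]; rfl,
    fun ξ => by rw [← F.map_lam, ← F'.map_lam]; rfl⟩

end BicObj

/-! ### Bichon's quantum automorphism group -/

/-- The defining relations of Bichon's quantum automorphism group, for a matrix `q` over a unital
C*-algebra indexed by the vertices. -/
structure BichonRelations {B : Type u} [CStarAlgebra B] (q : V → V → B) : Prop where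
  star_eq : ∀ v w, star (q v w) = q v w
  row : ∀ u v w, q v w * q v u = if w = u then q v w else 0
  col : ∀ u v w, q v w * q u w = if v = u then q v w else 0
  sum_row : ∀ v, ∑ w, q v w = 1
  sum_col : ∀ v, ∑ w, q w v = 1
  edge_left : ∀ e v w, ¬ 𝒢.IsEdge v w →
    q (𝒢.s e) v * q (𝒢.r e) w = 0 ∧ q (𝒢.r e) w * q (𝒢.s e) v = 0
  edge_right : ∀ e v w, ¬ 𝒢.IsEdge v w →
    q v (𝒢.s e) * q w (𝒢.r e) = 0 ∧ q w (𝒢.r e) * q v (𝒢.s e) = 0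
  comm : ∀ e f, q (𝒢.s e) (𝒢.s f) * q (𝒢.r e) (𝒢.r f) = q (𝒢.r e) (𝒢.r f) * q (𝒢.s e) (𝒢.s f)

/-- `A` is Bichon's quantum automorphism group of `𝒢`: `C(A)` is the universal unital C*-algebra
generated by a family `q v w`, indexed by pairs of vertices, subject to the relations above, with
the comultiplication `Δ(q v w) = ∑ᵤ q v u ⊗ q u w`. -/
def IsBichonQuantumAut (A : CompactQuantumGroup.{u}) : Prop :=
  ∃ q : V → V → A.C, 𝒢.BichonRelations q ∧
    (∀ (B : Type u) [CStarAlgebra B] (b : V → V → B), 𝒢.BichonRelations b →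
      ∃! f : A.C →⋆ₐ[ℂ] B, ∀ v w, f (q v w) = b v w) ∧
    ∀ v w, A.Δ (q v w) = ∑ u, MinTensor.tmul (q v u) (q u w)

end DirectedGraph
end

noncomputable section

/-! ### States -/

/-! An action on a finite space is a matrix `q` of coefficients: multiplicativity makes each row a
partition of unity into projections, and coassociativity is Δ(q_xy) = ∑ q_xz ⊗ q_zy. The analytic
point is that the Podleś condition makes the columns orthogonal as well (`coeff_col_orthogonal`), so
that `q` is a magic unitary. This is proved with states alone. If q_xy q_x'y ≠ 0, some vector state
φ detects it. Averaging convolution powers of φ and a Cauchy–Schwarz argument give a state h that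
absorbs φ (`exists_absorbing_state`). Such an h cannot distinguish rows x and x', although by the
Podleś condition the rows separate the points.

For an object (G, α, λ), inserting 1 = ∑_f λ_ef between α_{s(e)v} and α_{r(e)w} leaves the sum of
the λ_ef over the edges f from v to w (`coeff_source_mul_coeff_range`). The sum is self-adjoint, so
the two factors commute; it is empty if there is no such edge; it has at most one term if there are
no multiple edges. Hence α solves Bichon's relations (`bichonRelations`) and determines λ
(`coeff_lam`). Conversely, the matrix q_{s(e)s(f)} q_{r(e)r(f)} built from a solution is again
magic, and it supplies λ (`ofRelations`).

The universal algebra is the closure of the noncommutative polynomials inside the bounded families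
indexed by all solutions. It exists because the entries are projections, hence bounded, and because
solutions matter only through their norm functions on a free algebra, which form a set. The
relations pass to ∑ q_vu ⊗ q_uw, which defines Δ. The resulting object is terminal because a
morphism into it is prescribed on the generators. Uniqueness of terminal objects and of universal
algebras then gives the isomorphism for every choice of both. -/

theorem norm_one_le_one (A : Type u) [CStarAlgebra A] : ‖(1 : A)‖ ≤ 1 := by
  nontriviality A
  exact CStarRing.norm_one.le

/-- A state of a unital C*-algebra: a contractive functional mapping `1` to `1`. -/
structure IsState {A : Type u} [CStarAlgebra A] (f : A →L[ℂ] ℂ) : Prop where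
  apply_one : f 1 = 1
  norm_le : ∀ x, ‖f x‖ ≤ ‖x‖

namespace IsState

variable {A : Type u} [CStarAlgebra A] {f : A →L[ℂ] ℂ}

/-- Evaluating at a + it gives (Im f(a) + t)² ≤ ‖a‖² + t² for every real t. The t² cancels, and what
remains is linear in t, so its coefficient vanishes. -/
theorem im_eq_zero (hf : IsState f) {a : A} (ha : IsSelfAdjoint a) : (f a).im = 0 := by
  have key : ∀ t : ℝ, ((f a).im + t) ^ 2 ≤ ‖a‖ ^ 2 + t ^ 2 := fun t => by
    have h1 : f (a + (t * Complex.I : ℂ) • 1) = f a + t * Complex.I := by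
      rw [map_add, map_smul, hf.apply_one, smul_eq_mul, mul_one]
    have h2 : ‖a + (t * Complex.I : ℂ) • (1 : A)‖ ^ 2 ≤ ‖a‖ ^ 2 + t ^ 2 := by
      rw [sq, ← CStarRing.norm_star_mul_self]
      have : star (a + (t * Complex.I : ℂ) • (1 : A)) * (a + (t * Complex.I : ℂ) • 1)
          = a * a + ((t ^ 2 : ℝ) : ℂ) • 1 := by
        rw [star_add, star_smul, star_one, ha.star_eq]
        simp only [add_mul, mul_add, smul_mul_assoc, one_mul, mul_smul_comm, mul_one]
        have hI : star ((t : ℂ) * Complex.I) = -(t * Complex.I) := by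
          simp
        have h2 : ((t ^ 2 : ℝ) : ℂ) = -((t * Complex.I) * (t * Complex.I)) := by
          push_cast; linear_combination ((t : ℂ) ^ 2) * Complex.I_sq
        rw [hI, h2]
        module
      rw [this]
      refine (norm_add_le _ _).trans (add_le_add ?_ ?_)
      · rw [sq]; exact norm_mul_le _ _
      · refine (norm_smul_le _ _).trans ?_
        rw [Complex.norm_real, Real.norm_of_nonneg (sq_nonneg t)]
        nlinarith [sq_nonneg t, norm_one_le_one A]
    have h3 := hf.norm_le (a + (t * Complex.I : ℂ) • 1)
    rw [h1] at h3
    have h4 : ((f a).im + t) ^ 2 ≤ ‖f a + t * Complex.I‖ ^ 2 := by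
      rw [Complex.sq_norm, Complex.normSq_apply]
      simp; nlinarith [sq_nonneg (f a).re]
    exact h4.trans ((pow_le_pow_left₀ (norm_nonneg _) h3 2).trans h2)
  by_contra hne
  -- This t makes the cross term 2 t Im f(a) equal to 2(‖a‖² + 1), which is too large.
  have := key ((‖a‖ ^ 2 + 1) / (f a).im)
  have e : (f a).im * ((‖a‖ ^ 2 + 1) / (f a).im) = ‖a‖ ^ 2 + 1 := by field_simp
  nlinarith [sq_nonneg (f a).im, sq_nonneg ‖a‖]

-- From 0 ≤ a ≤ ‖a‖ one gets ‖‖a‖ - a‖ ≤ ‖a‖. Thus f(a) lies in the disc of radius ‖a‖ around ‖a‖,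
-- and it is real.
open scoped ComplexOrder in
theorem nonneg_of_nonneg (hf : IsState f) [PartialOrder A] [StarOrderedRing A] {a : A}
    (ha : 0 ≤ a) : 0 ≤ f a := by
  have hsa := IsSelfAdjoint.of_nonneg ha
  have hle : a ≤ algebraMap ℝ A ‖a‖ := hsa.le_algebraMap_norm_self
  have h1 : ‖algebraMap ℝ A ‖a‖ - a‖ ≤ ‖a‖ := by
    refine (CStarAlgebra.norm_le_norm_of_nonneg_of_le (sub_nonneg.mpr hle)
      (sub_le_self _ ha)).trans ?_
    rw [Algebra.algebraMap_eq_smul_one]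
    refine (norm_smul_le _ _).trans ?_
    rw [Real.norm_of_nonneg (norm_nonneg a)]
    nlinarith [norm_nonneg a, norm_one_le_one A]
  have h2 := (hf.norm_le _).trans h1
  have h3 : f (algebraMap ℝ A ‖a‖ - a) = ‖a‖ - f a := by
    rw [map_sub, Algebra.algebraMap_eq_smul_one, ← Complex.coe_smul, map_smul, hf.apply_one,
      smul_eq_mul, mul_one]
  rw [h3] at h2
  refine Complex.nonneg_iff.mpr ⟨?_, (hf.im_eq_zero hsa).symm⟩
  have := (Complex.re_le_norm _).trans h2
  simp at this
  exact this

open scoped ComplexOrder in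
/-- The GNS representation of a state. -/
theorem exists_rep (hf : IsState f) : ∃ (π : HilbertRep A) (ξ : π.H), ‖ξ‖ = 1 ∧
    ∀ a, f a = Inner.inner ℂ ξ (π.hom a ξ) := by
  let _ := CStarAlgebra.spectralOrder A
  have := CStarAlgebra.spectralOrderedRing A
  let F : A →ₚ[ℂ] ℂ := PositiveLinearMap.mk₀ f.toLinearMap fun a ha => hf.nonneg_of_nonneg ha
  have hF : ∀ a, F a = f a := fun a => rfl
  let ξ : F.GNS := ((F.toPreGNS 1 : F.PreGNS) : F.GNS)
  have hξ : ‖ξ‖ = 1 := by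
    have h := F.preGNS_norm_def (F.toPreGNS 1)
    rw [UniformSpace.Completion.norm_coe, h]
    simp [hF, hf.apply_one]
  have : Nontrivial F.GNS := ⟨⟨ξ, 0, fun h => by rw [h, norm_zero] at hξ; exact zero_ne_one hξ⟩⟩
  refine ⟨⟨F.GNS, F.gnsStarAlgHom⟩, ξ, hξ, fun a => ?_⟩
  show f a = Inner.inner ℂ ξ (F.gnsNonUnitalStarAlgHom a ξ)
  rw [F.gnsNonUnitalStarAlgHom_apply_coe, UniformSpace.Completion.inner_coe, F.preGNS_inner_def]
  simp [hF]

theorem of_rep (π : HilbertRep A) {ξ : π.H} (hξ : ‖ξ‖ = 1) 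
    (h : ∀ a, f a = Inner.inner ℂ ξ (π.hom a ξ)) : IsState f where
  apply_one := by
    have h1 : f 1 = Inner.inner ℂ ξ ξ := by rw [h, map_one]; rfl
    rw [h1, inner_self_eq_norm_sq_to_K, hξ]; simp
  norm_le x := by
    rw [h]
    refine (norm_inner_le_norm _ _).trans ?_
    rw [hξ, one_mul]
    refine (ContinuousLinearMap.le_opNorm _ _).trans ?_
    rw [hξ, mul_one]
    exact π.norm_hom_le x

end IsState

theorem HilbertRep.inner_hom_left {A : Type u} [CStarAlgebra A] (π : HilbertRep A) (a : A)
    (x y : π.H) : Inner.inner ℂ (π.hom a x) y = Inner.inner ℂ x (π.hom (star a) y) := by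
  rw [map_star, ContinuousLinearMap.star_eq_adjoint, ContinuousLinearMap.adjoint_inner_right]

namespace IsState

variable {A : Type u} [CStarAlgebra A] {f : A →L[ℂ] ℂ}

theorem apply_star (hf : IsState f) (a : A) : f (star a) = star (f a) := by
  obtain ⟨π, ξ, -, h⟩ := hf.exists_rep
  rw [h, h, ← π.inner_hom_left, RCLike.star_def, inner_conj_symm]

/-- Cauchy–Schwarz in GNS form: the hypothesis says that x kills the cyclic vector. -/
theorem apply_mul_eq_zero (hf : IsState f) {x : A} (hx : f (star x * x) = 0) (y : A) :
    f (y * x) = 0 := by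
  obtain ⟨π, ξ, -, h⟩ := hf.exists_rep
  have h0 : π.hom x ξ = 0 := by
    rw [h, map_mul, mul_apply_eq_comp, ← π.inner_hom_left] at hx
    exact inner_self_eq_zero.mp hx
  rw [h, map_mul, mul_apply_eq_comp, h0, map_zero, inner_zero_right]

/-- A character of the C*-algebra generated by a attains the spectral radius, which is the norm as a
is self-adjoint. Its Hahn–Banach extension still has norm at most 1 and value 1 at the unit. -/
theorem exists_norm_eq {a : A} [Nontrivial A] (ha : IsSelfAdjoint a) :
    ∃ f : A →L[ℂ] ℂ, IsState f ∧ ‖f a‖ = ‖a‖ := by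
  have : IsStarNormal a := ha.isStarNormal
  let b : StarAlgebra.elemental ℂ a := ⟨a, StarAlgebra.elemental.self_mem ℂ a⟩
  have hb : IsSelfAdjoint b := Subtype.ext ha
  obtain ⟨z, hz, hz'⟩ := spectrum.exists_nnnorm_eq_spectralRadius b
  rw [hb.spectralRadius_eq_nnnorm] at hz'
  have hz2 : ‖z‖ = ‖a‖ := congrArg NNReal.toReal (ENNReal.coe_injective hz')
  obtain ⟨χ, hχ⟩ := WeakDual.CharacterSpace.mem_spectrum_iff_exists.mp hz
  obtain ⟨f, hf, hf'⟩ := exists_extension_norm_eq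
    (StarAlgebra.elemental ℂ a).toSubalgebra.toSubmodule (WeakDual.toStrongDual (χ : WeakDual ℂ _))
  refine ⟨f, ⟨?_, fun x => ?_⟩, ?_⟩
  · refine (hf (1 : StarAlgebra.elemental ℂ a)).trans (map_one χ)
  · refine (f.le_opNorm x).trans ?_
    rw [hf']
    refine mul_le_of_le_one_left (norm_nonneg x) ?_
    exact (WeakDual.CharacterSpace.norm_le_norm_one χ).trans (norm_one_le_one _)
  · rw [← hz2, ← hχ]
    exact congrArg norm (hf b)

/-- The norm of an element of a C*-algebra is attained in some representation. -/
theorem exists_rep_norm_eq [Nontrivial A] (a : A) :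
    ∃ (π : HilbertRep A) (ξ : π.H), ‖ξ‖ = 1 ∧ ‖π.hom a ξ‖ = ‖a‖ := by
  obtain ⟨f, hf, hfa⟩ := exists_norm_eq (IsSelfAdjoint.star_mul_self a)
  obtain ⟨π, ξ, hξ, h⟩ := hf.exists_rep
  refine ⟨π, ξ, hξ, ?_⟩
  rw [h, map_mul, mul_apply_eq_comp, ← π.inner_hom_left, inner_self_eq_norm_sq_to_K,
    CStarRing.norm_star_mul_self] at hfa
  simpa [← sq] using hfa

end IsState

/-! ### Slice maps -/

/-- The continuous linear map underlying a `*`-homomorphism of C*-algebras. -/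
def StarAlgHom.toCLM {A B : Type*} [CStarAlgebra A] [CStarAlgebra B] (f : A →⋆ₐ[ℂ] B) :
    A →L[ℂ] B :=
  f.toAlgHom.toLinearMap.mkContinuous 1 fun x => by
    rw [one_mul]; exact NonUnitalStarAlgHom.norm_apply_le f x

@[simp] theorem StarAlgHom.toCLM_apply {A B : Type*} [CStarAlgebra A] [CStarAlgebra B]
    (f : A →⋆ₐ[ℂ] B) (a : A) : f.toCLM a = f a := rfl

/-- Functionals of the form `a ↦ ⟪ξ, π(a) η⟫` for a representation `π`. -/
def IsVectorFunctional {A : Type u} [CStarAlgebra A] (f : A →L[ℂ] ℂ) : Prop :=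
  ∃ (π : HilbertRep A) (ξ η : π.H), ∀ a, f a = Inner.inner ℂ ξ (π.hom a η)

theorem IsState.isVectorFunctional {A : Type u} [CStarAlgebra A] {f : A →L[ℂ] ℂ}
    (hf : IsState f) : IsVectorFunctional f := by
  obtain ⟨π, ξ, -, h⟩ := hf.exists_rep
  exact ⟨π, ξ, ξ, h⟩

/-- States are not closed under f ↦ f(c ·). Vector functionals are, since c can be moved to the left
vector, and their slice maps are still bounded. -/
theorem IsVectorFunctional.comp_mul {A : Type u} [CStarAlgebra A] {f : A →L[ℂ] ℂ}
    (hf : IsVectorFunctional f) (c : A) :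
    IsVectorFunctional (f ∘L ContinuousLinearMap.mul ℂ A c) := by
  obtain ⟨π, ξ, η, h⟩ := hf
  refine ⟨π, π.hom (star c) ξ, η, fun a => ?_⟩
  rw [π.inner_hom_left, star_star, ← mul_apply_eq_comp, ← map_mul]
  exact h _

namespace MinTensor

variable {A B C D : Type u} [CStarAlgebra A] [CStarAlgebra B] [CStarAlgebra C] [CStarAlgebra D]

theorem tmul_mul_tmul (a a' : A) (b b' : B) :
    tmul a b * tmul a' b' = tmul (a * a') (b * b') := by
  rw [tmul, tmul, tmul, ← map_mul, Algebra.TensorProduct.tmul_mul_tmul]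

theorem star_tmul (a : A) (b : B) : star (tmul a b) = tmul (star a) (star b) := by
  rw [tmul, tmul, ← map_star, TensorProduct.star_tmul]

theorem tmul_one_one : tmul (1 : A) (1 : B) = 1 := map_one (of A B)

variable (A B) in
/-- The bilinear map `(a, b) ↦ a ⊗ b`. -/
def tmulBilin : A →ₗ[ℂ] B →ₗ[ℂ] MinTensor A B :=
  (TensorProduct.mk ℂ A B).compr₂ (of A B).toAlgHom.toLinearMap

theorem tmulBilin_apply (a : A) (b : B) : tmulBilin A B a b = tmul a b := rfl

theorem clm_ext {E : Type*} [NormedAddCommGroup E] [NormedSpace ℂ E]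
    {f g : MinTensor A B →L[ℂ] E} (h : ∀ a b, f (tmul a b) = g (tmul a b)) : f = g := by
  refine ContinuousLinearMap.ext fun x => denseRange_of.induction_on x
    (isClosed_eq f.continuous g.continuous) fun y => ?_
  induction y using TensorProduct.induction_on with
  | zero => rw [map_zero, map_zero, map_zero]
  | add y z hy hz => rw [map_add, map_add, map_add, hy, hz]
  | tmul a b => exact h a b

/-- The form in which coassociativity is used: iterated slices of the two sides are compared on
elementary tensors only, without an associativity isomorphism. -/
theorem AssocEq.apply_eq {E : Type*} [NormedAddCommGroup E] [NormedSpace ℂ E]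
    {y : MinTensor (MinTensor A B) C} {x : MinTensor A (MinTensor B C)} (hyx : AssocEq y x)
    (f : MinTensor (MinTensor A B) C →L[ℂ] E) (g : MinTensor A (MinTensor B C) →L[ℂ] E)
    (h : ∀ a b c, f (tmul (tmul a b) c) = g (tmul a (tmul b c))) : f y = g x := by
  have hcl : IsClosed {p : MinTensor (MinTensor A B) C × MinTensor A (MinTensor B C) |
      f p.1 = g p.2} :=
    isClosed_eq (f.continuous.comp continuous_fst) (g.continuous.comp continuous_snd)
  refine closure_minimal (fun p hp => ?_) hcl hyx
  induction hp using Submodule.span_induction with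
  | mem p hp => obtain ⟨a, b, c, rfl⟩ := hp; exact h a b c
  | zero => simp
  | add p q _ _ hp hq =>
    simp only [Set.mem_ofPred_eq] at hp hq ⊢
    rw [Prod.fst_add, Prod.snd_add, map_add, map_add, hp, hq]
  | smul c p _ hp =>
    simp only [Set.mem_ofPred_eq] at hp ⊢
    rw [Prod.smul_fst, Prod.smul_snd, map_smul, map_smul, hp]

variable (A) in
/-- `id ⊗ f` on the algebraic tensor product. -/
def algSliceRight (f : B →L[ℂ] ℂ) : A ⊗[ℂ] B →ₗ[ℂ] A :=
  (TensorProduct.rid ℂ A).toLinearMap ∘ₗ LinearMap.lTensor A f.toLinearMap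

theorem algSliceRight_tmul (f : B →L[ℂ] ℂ) (a : A) (b : B) :
    algSliceRight A f (a ⊗ₜ b) = f b • a := rfl

variable (B) in
/-- `f ⊗ id` on the algebraic tensor product. -/
def algSliceLeft (f : A →L[ℂ] ℂ) : A ⊗[ℂ] B →ₗ[ℂ] B :=
  (TensorProduct.lid ℂ B).toLinearMap ∘ₗ LinearMap.rTensor B f.toLinearMap

theorem algSliceLeft_tmul (f : A →L[ℂ] ℂ) (a : A) (b : B) :
    algSliceLeft B f (a ⊗ₜ b) = f a • b := rfl

theorem inner_tensor_tmul (ρ : HilbertRep A) (π : HilbertRep B) (ζ θ : ρ.H) (ξ η : π.H)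
    (a : A) (b : B) :
    Inner.inner ℂ (HilbertTensor.coe ρ.H π.H (ζ ⊗ₜ ξ))
      (HilbertRep.tensorLin ρ π (a ⊗ₜ b) (HilbertTensor.coe ρ.H π.H (θ ⊗ₜ η))) =
    Inner.inner ℂ ζ (ρ.hom a θ) * Inner.inner ℂ ξ (π.hom b η) := by
  have h : HilbertRep.tensorLin ρ π (a ⊗ₜ b) (HilbertTensor.coe ρ.H π.H (θ ⊗ₜ η)) =
      HilbertTensor.coe ρ.H π.H (ρ.hom a θ ⊗ₜ π.hom b η) :=
    by
    rw [HilbertRep.tensorLin_tmul, HilbertTensor.op_coe, TensorProduct.mapL_tmul]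
  rw [h, LinearIsometry.inner_map_map, TensorProduct.inner_tmul]

theorem norm_inner_tensor_le (ρ : HilbertRep A) (π : HilbertRep B) (ζ θ : ρ.H) (ξ η : π.H)
    (x : A ⊗[ℂ] B) :
    ‖(Inner.inner ℂ (HilbertTensor.coe ρ.H π.H (ζ ⊗ₜ ξ))
      (HilbertRep.tensorLin ρ π x (HilbertTensor.coe ρ.H π.H (θ ⊗ₜ η))) : ℂ)‖ ≤
    ‖ζ‖ * ‖ξ‖ * (‖of A B x‖ * (‖θ‖ * ‖η‖)) := by
  refine (norm_inner_le_norm _ _).trans ?_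
  have e : ∀ (s : ρ.H) (t : π.H), ‖HilbertTensor.coe ρ.H π.H (s ⊗ₜ t)‖ = ‖s‖ * ‖t‖ := fun s t =>
    ((HilbertTensor.coe ρ.H π.H).norm_map _).trans (TensorProduct.norm_tmul s t)
  refine mul_le_mul (e ζ ξ).le ?_ (norm_nonneg _) (by positivity)
  refine (ContinuousLinearMap.le_opNorm _ _).trans ?_
  exact mul_le_mul (norm_tensor_le ρ π x) (e θ η).le (norm_nonneg _) (norm_nonneg _)

theorem le_of_sq_le_mul {s t : ℝ} (hs : 0 ≤ s) (ht : 0 ≤ t) (h : s * s ≤ s * t) : s ≤ t := by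
  rcases hs.eq_or_lt with rfl | hs
  · exact ht
  · exact le_of_mul_le_mul_left h hs

/-- Let y be the slice of x and θ a unit vector at which a representation ρ attains ‖y‖. Then ‖y‖² =
⟨ρ(y)θ, ρ(y)θ⟩ is the coefficient of (ρ ⊗ π)(x) between ρ(y)θ ⊗ ξ and θ ⊗ η, which is at most ‖y‖
‖ξ‖ ‖x‖ ‖η‖. Cancel ‖y‖. -/
theorem norm_algSliceRight_le {f : B →L[ℂ] ℂ} {π : HilbertRep B} {ξ η : π.H}
    (h : ∀ b, f b = Inner.inner ℂ ξ (π.hom b η)) (x : A ⊗[ℂ] B) :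
    ‖algSliceRight A f x‖ ≤ ‖ξ‖ * ‖η‖ * ‖of A B x‖ := by
  cases subsingleton_or_nontrivial A with
  | inl _ => rw [Subsingleton.elim (algSliceRight A f x) 0, norm_zero]; positivity
  | inr _ =>
    obtain ⟨ρ, θ, hθ, hn⟩ := IsState.exists_rep_norm_eq (algSliceRight A f x)
    have key : ∀ (ζ : ρ.H) (x : A ⊗[ℂ] B), Inner.inner ℂ ζ (ρ.hom (algSliceRight A f x) θ) =
        Inner.inner ℂ (HilbertTensor.coe ρ.H π.H (ζ ⊗ₜ ξ))
          (HilbertRep.tensorLin ρ π x (HilbertTensor.coe ρ.H π.H (θ ⊗ₜ η))) := fun ζ x => by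
      induction x using TensorProduct.induction_on with
      | zero => simp only [map_zero, zero_apply, inner_zero_right]
      | add y z hy hz => simp only [map_add, add_apply, inner_add_right, hy, hz]
      | tmul a b =>
        rw [inner_tensor_tmul, algSliceRight_tmul, map_smul, smul_apply,
          inner_smul_right, h, mul_comm]
    have h1 := norm_inner_tensor_le ρ π (ρ.hom (algSliceRight A f x) θ) θ ξ η x
    rw [← key, inner_self_eq_norm_sq_to_K, hn, hθ] at h1
    refine le_of_sq_le_mul (norm_nonneg _) (by positivity) ?_
    rw [norm_pow, RCLike.norm_ofReal, abs_norm, sq] at h1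
    linarith

theorem norm_algSliceLeft_le {f : A →L[ℂ] ℂ} {π : HilbertRep A} {ξ η : π.H}
    (h : ∀ a, f a = Inner.inner ℂ ξ (π.hom a η)) (x : A ⊗[ℂ] B) :
    ‖algSliceLeft B f x‖ ≤ ‖ξ‖ * ‖η‖ * ‖of A B x‖ := by
  cases subsingleton_or_nontrivial B with
  | inl _ => rw [Subsingleton.elim (algSliceLeft B f x) 0, norm_zero]; positivity
  | inr _ =>
    obtain ⟨ρ, θ, hθ, hn⟩ := IsState.exists_rep_norm_eq (algSliceLeft B f x)
    have key : ∀ (ζ : ρ.H) (x : A ⊗[ℂ] B), Inner.inner ℂ ζ (ρ.hom (algSliceLeft B f x) θ) =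
        Inner.inner ℂ (HilbertTensor.coe π.H ρ.H (ξ ⊗ₜ ζ))
          (HilbertRep.tensorLin π ρ x (HilbertTensor.coe π.H ρ.H (η ⊗ₜ θ))) := fun ζ x => by
      induction x using TensorProduct.induction_on with
      | zero => simp only [map_zero, zero_apply, inner_zero_right]
      | add y z hy hz => simp only [map_add, add_apply, inner_add_right, hy, hz]
      | tmul a b =>
        rw [inner_tensor_tmul, algSliceLeft_tmul, map_smul, smul_apply,
          inner_smul_right, h]
    have h1 := norm_inner_tensor_le π ρ ξ η (ρ.hom (algSliceLeft B f x) θ) θ x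
    rw [← key, inner_self_eq_norm_sq_to_K, hn, hθ] at h1
    refine le_of_sq_le_mul (norm_nonneg _) (by positivity) ?_
    rw [norm_pow, RCLike.norm_ofReal, abs_norm, sq] at h1
    linarith

variable (A) in
/-- The slice map `id ⊗ f`. -/
def sliceRight (f : B →L[ℂ] ℂ) : MinTensor A B →L[ℂ] A :=
  (algSliceRight A f).extendOfNorm (of A B).toAlgHom.toLinearMap

variable (B) in
/-- The slice map `f ⊗ id`. -/
def sliceLeft (f : A →L[ℂ] ℂ) : MinTensor A B →L[ℂ] B :=
  (algSliceLeft B f).extendOfNorm (of A B).toAlgHom.toLinearMap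

theorem sliceRight_tmul {f : B →L[ℂ] ℂ} (hf : IsVectorFunctional f) (a : A) (b : B) :
    sliceRight A f (tmul a b) = f b • a := by
  obtain ⟨π, ξ, η, h⟩ := hf
  exact LinearMap.extendOfNorm_eq (e := (of A B).toAlgHom.toLinearMap) denseRange_of
    ⟨_, norm_algSliceRight_le h⟩ (a ⊗ₜ b)

theorem sliceLeft_tmul {f : A →L[ℂ] ℂ} (hf : IsVectorFunctional f) (a : A) (b : B) :
    sliceLeft B f (tmul a b) = f a • b := by
  obtain ⟨π, ξ, η, h⟩ := hf
  exact LinearMap.extendOfNorm_eq (e := (of A B).toAlgHom.toLinearMap) denseRange_of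
    ⟨_, norm_algSliceLeft_le h⟩ (a ⊗ₜ b)

theorem norm_sliceRight_le {f : B →L[ℂ] ℂ} (hf : IsState f) (x : MinTensor A B) :
    ‖sliceRight A f x‖ ≤ ‖x‖ := by
  obtain ⟨π, ξ, hξ, h⟩ := hf.exists_rep
  have := LinearMap.norm_extendOfNorm_apply_le (f := algSliceRight A f)
    (e := (of A B).toAlgHom.toLinearMap) denseRange_of _ (norm_algSliceRight_le h) x
  rwa [hξ, one_mul, one_mul] at this

theorem norm_sliceLeft_le {f : A →L[ℂ] ℂ} (hf : IsState f) (x : MinTensor A B) :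
    ‖sliceLeft B f x‖ ≤ ‖x‖ := by
  obtain ⟨π, ξ, hξ, h⟩ := hf.exists_rep
  have := LinearMap.norm_extendOfNorm_apply_le (f := algSliceLeft B f)
    (e := (of A B).toAlgHom.toLinearMap) denseRange_of _ (norm_algSliceLeft_le h) x
  rwa [hξ, one_mul, one_mul] at this

theorem sliceRight_one {f : B →L[ℂ] ℂ} (hf : IsState f) : sliceRight A f 1 = 1 := by
  rw [← tmul_one_one, sliceRight_tmul hf.isVectorFunctional, hf.apply_one, one_smul]

theorem sliceLeft_one {f : A →L[ℂ] ℂ} (hf : IsState f) : sliceLeft B f 1 = 1 := by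
  rw [← tmul_one_one, sliceLeft_tmul hf.isVectorFunctional, hf.apply_one, one_smul]

/-- Slicing both legs, in either order. -/
theorem apply_sliceRight {f : A →L[ℂ] ℂ} {g : B →L[ℂ] ℂ} (hf : IsVectorFunctional f)
    (hg : IsVectorFunctional g) (x : MinTensor A B) :
    f (sliceRight A g x) = g (sliceLeft B f x) :=
  DFunLike.congr_fun (clm_ext (f := f ∘L sliceRight A g) (g := g ∘L sliceLeft B f) fun a b => by
    simp only [ContinuousLinearMap.comp_apply, sliceRight_tmul hg, sliceLeft_tmul hf, map_smul,
      smul_eq_mul, mul_comm]) x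

theorem sliceRight_map_id {f : B →L[ℂ] ℂ} (hf : IsVectorFunctional f) (g : A →⋆ₐ[ℂ] D)
    (x : MinTensor A B) :
    sliceRight D f (map g (StarAlgHom.id ℂ B) x) = g (sliceRight A f x) :=
  DFunLike.congr_fun (clm_ext (f := sliceRight D f ∘L (map g (StarAlgHom.id ℂ B)).toCLM)
    (g := g.toCLM ∘L sliceRight A f) fun a b => by
    simp only [ContinuousLinearMap.comp_apply, StarAlgHom.toCLM_apply, map_tmul,
      sliceRight_tmul hf, map_smul]
    rfl) x

theorem sliceLeft_id_map {f : A →L[ℂ] ℂ} (hf : IsVectorFunctional f) (g : B →⋆ₐ[ℂ] D)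
    (x : MinTensor A B) :
    sliceLeft D f (map (StarAlgHom.id ℂ A) g x) = g (sliceLeft B f x) :=
  DFunLike.congr_fun (clm_ext (f := sliceLeft D f ∘L (map (StarAlgHom.id ℂ A) g).toCLM)
    (g := g.toCLM ∘L sliceLeft B f) fun a b => by
    simp only [ContinuousLinearMap.comp_apply, StarAlgHom.toCLM_apply, map_tmul,
      sliceLeft_tmul hf, map_smul]
    rfl) x

theorem sliceRight_id_map {f : D →L[ℂ] ℂ} (hf : IsVectorFunctional f) (g : B →⋆ₐ[ℂ] D)
    (hfg : IsVectorFunctional (f ∘L g.toCLM)) (x : MinTensor A B) :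
    sliceRight A f (map (StarAlgHom.id ℂ A) g x) = sliceRight A (f ∘L g.toCLM) x :=
  DFunLike.congr_fun (clm_ext (f := sliceRight A f ∘L (map (StarAlgHom.id ℂ A) g).toCLM)
    (g := sliceRight A (f ∘L g.toCLM)) fun a b => by
    simp only [ContinuousLinearMap.comp_apply, StarAlgHom.toCLM_apply, map_tmul,
      sliceRight_tmul hf, sliceRight_tmul hfg]
    rfl) x

theorem sliceRight_tmul_mul {f : B →L[ℂ] ℂ} (hf : IsVectorFunctional f) (a : A) (b : B)
    (x : MinTensor A B) :
    sliceRight A f (tmul a b * x) = a * sliceRight A (f ∘L ContinuousLinearMap.mul ℂ B b) x :=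
  DFunLike.congr_fun (clm_ext
    (f := sliceRight A f ∘L ContinuousLinearMap.mul ℂ (MinTensor A B) (tmul a b))
    (g := ContinuousLinearMap.mul ℂ A a ∘L sliceRight A (f ∘L ContinuousLinearMap.mul ℂ B b))
    fun c d => by
      show sliceRight A f (tmul a b * tmul c d) = a * sliceRight A _ (tmul c d)
      rw [tmul_mul_tmul, sliceRight_tmul hf, sliceRight_tmul (hf.comp_mul b), mul_smul_comm]
      rfl) x

theorem sliceLeft_tmul_mul {f : A →L[ℂ] ℂ} (hf : IsVectorFunctional f) (a : A) (b : B)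
    (x : MinTensor A B) :
    sliceLeft B f (tmul a b * x) = b * sliceLeft B (f ∘L ContinuousLinearMap.mul ℂ A a) x :=
  DFunLike.congr_fun (clm_ext
    (f := sliceLeft B f ∘L ContinuousLinearMap.mul ℂ (MinTensor A B) (tmul a b))
    (g := ContinuousLinearMap.mul ℂ B b ∘L sliceLeft B (f ∘L ContinuousLinearMap.mul ℂ A a))
    fun c d => by
      show sliceLeft B f (tmul a b * tmul c d) = b * sliceLeft B _ (tmul c d)
      rw [tmul_mul_tmul, sliceLeft_tmul hf, sliceLeft_tmul (hf.comp_mul a), mul_smul_comm]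
      rfl) x

end MinTensor

/-! ### Invariant states -/

theorem IsState.comp {A B : Type u} [CStarAlgebra A] [CStarAlgebra B] {f : B →L[ℂ] ℂ}
    (hf : IsState f) {T : A →L[ℂ] B} (h1 : T 1 = 1) (hT : ∀ x, ‖T x‖ ≤ ‖x‖) :
    IsState (f ∘L T) where
  apply_one := by rw [ContinuousLinearMap.comp_apply, h1, hf.apply_one]
  norm_le x := (hf.norm_le _).trans (hT x)

/-- A unital contraction of a C*-algebra has an invariant state, which can be found among the
limits of the averages of the orbit of a given state. -/
theorem IsState.exists_invariant {A : Type u} [CStarAlgebra A] {f : A →L[ℂ] ℂ} (hf : IsState f)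
    {T : A →L[ℂ] A} (h1 : T 1 = 1) (hT : ∀ x, ‖T x‖ ≤ ‖x‖) :
    ∃ h : A →L[ℂ] ℂ, IsState h ∧ (∀ a, h (T a) = h a) ∧
      ∀ S : A →L[ℂ] A, (∀ a, S (T a) = T (S a)) → (∀ a, f (S a) = f a) → ∀ a, h (S a) = h a := by
  have hiter1 : ∀ k : ℕ, T^[k] 1 = 1 := fun k => Function.iterate_fixed h1 k
  have hiter : ∀ (k : ℕ) x, ‖T^[k] x‖ ≤ ‖x‖ := fun k x => by
    induction k with
    | zero => exact le_rfl
    | succ k ih => rw [Function.iterate_succ_apply']; exact (hT _).trans ih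
  -- Cesàro averages of the orbit of f, with n + 1 terms so that no denominator is zero.
  let F : ℕ → (A →L[ℂ] ℂ) := fun n =>
    ((n + 1 : ℝ)⁻¹ : ℂ) • ∑ k ∈ Finset.range (n + 1), f ∘L (T ^ k)
  have hF : ∀ n a, F n a = ((n + 1 : ℝ)⁻¹ : ℂ) * ∑ k ∈ Finset.range (n + 1), f (T^[k] a) := by
    intro n a
    simp only [F, smul_apply, sum_apply,
      ContinuousLinearMap.comp_apply, smul_eq_mul, FunLike.coe_pow_eq_iterate]
  have hFle : ∀ n a, ‖F n a‖ ≤ ‖a‖ := fun n a => by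
    rw [hF, norm_mul]
    have : ‖∑ k ∈ Finset.range (n + 1), f (T^[k] a)‖ ≤ (n + 1) * ‖a‖ := by
      refine (norm_sum_le_of_le _ fun k _ => (hf.norm_le _).trans (hiter k a)).trans ?_
      simp
    have hn : ‖((n + 1 : ℝ)⁻¹ : ℂ)‖ = (n + 1 : ℝ)⁻¹ := by
      rw [← Complex.ofReal_inv, Complex.norm_real, Real.norm_of_nonneg (by positivity)]
    rw [hn]
    calc (n + 1 : ℝ)⁻¹ * ‖∑ k ∈ Finset.range (n + 1), f (T^[k] a)‖
        ≤ (n + 1 : ℝ)⁻¹ * ((n + 1) * ‖a‖) := by gcongr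
      _ = ‖a‖ := by field_simp
  let W : ℕ → WeakDual ℂ A := fun n => StrongDual.toWeakDual (F n)
  have hW : ∀ n, W n ∈ WeakDual.toStrongDual ⁻¹' Metric.closedBall (0 : StrongDual ℂ A) 1 := by
    intro n
    rw [Set.mem_preimage, mem_closedBall_zero_iff]
    exact ContinuousLinearMap.opNorm_le_bound _ zero_le_one fun a => by
      rw [one_mul]; exact hFle n a
  -- Banach–Alaoglu. The weak* limit is taken along a free ultrafilter, since the ball need not be
  -- sequentially compact.
  obtain ⟨h, hh, hlim⟩ := (WeakDual.isCompact_closedBall (0 : StrongDual ℂ A) 1).ultrafilter_le_nhds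
    ((Filter.hyperfilter ℕ).map W) (by
      rw [Filter.le_principal_iff]
      exact Filter.mem_map.mpr (Filter.univ_mem' hW))
  have hlim' : ∀ a, Filter.Tendsto (fun n => F n a) (Filter.hyperfilter ℕ) (nhds (h a)) :=
    fun a => ((WeakDual.eval_continuous a).tendsto h).comp hlim
  have hle : (Filter.hyperfilter ℕ : Filter ℕ) ≤ Filter.atTop := Nat.hyperfilter_le_atTop
  refine ⟨WeakDual.toStrongDual h, ⟨?_, fun x => ?_⟩, fun a => ?_, fun S hS hfS a => ?_⟩
  · refine tendsto_nhds_unique (hlim' 1) ?_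
    refine Filter.Tendsto.congr (fun n => ?_) tendsto_const_nhds
    rw [hF]
    simp only [hiter1, hf.apply_one, Finset.sum_const, Finset.card_range, nsmul_eq_mul, mul_one]
    push_cast
    rw [inv_mul_cancel₀]
    exact_mod_cast n.succ_ne_zero
  · exact le_of_tendsto (hlim' x).norm (Filter.Eventually.of_forall fun n => hFle n x)
  · have hd := (hlim' (T a)).sub (hlim' a)
    have hz : Filter.Tendsto (fun n => F n (T a) - F n a) (Filter.hyperfilter ℕ) (nhds 0) := by
      -- The difference of averages telescopes to its two end terms, divided by n + 1.
      have hb : ∀ n, ‖F n (T a) - F n a‖ ≤ (2 * ‖a‖) * (1 / ((n : ℝ) + 1)) := fun n => by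
        rw [hF, hF, ← mul_sub, ← Finset.sum_sub_distrib]
        have : ∀ k, f (T^[k] (T a)) - f (T^[k] a) = f (T^[k+1] a) - f (T^[k] a) := fun k => by
          rw [Function.iterate_succ_apply]
        simp only [this]
        rw [Finset.sum_range_sub (fun k => f (T^[k] a)), norm_mul]
        have hn : ‖((n + 1 : ℝ)⁻¹ : ℂ)‖ = (n + 1 : ℝ)⁻¹ := by
          rw [← Complex.ofReal_inv, Complex.norm_real, Real.norm_of_nonneg (by positivity)]
        rw [hn, mul_comm, one_div]
        gcongr
        refine (norm_sub_le _ _).trans ?_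
        rw [two_mul]
        exact add_le_add ((hf.norm_le _).trans (hiter _ a)) ((hf.norm_le _).trans (hiter _ a))
      refine squeeze_zero_norm hb ?_
      have := (tendsto_one_div_add_atTop_nhds_zero_nat (𝕜 := ℝ)).const_mul (2 * ‖a‖)
      rw [mul_zero] at this
      exact this.mono_left hle
    exact sub_eq_zero.mp (tendsto_nhds_unique hd hz)
  · have : ∀ k, f (T^[k] (S a)) = f (T^[k] a) := fun k => by
      have hc : T^[k] (S a) = S (T^[k] a) :=
        ((Function.Commute.iterate_right (f := S) (g := T) hS k) a).symm
      rw [hc, hfS]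
    refine tendsto_nhds_unique (hlim' (S a)) ((hlim' a).congr fun n => ?_)
    rw [hF, hF]
    simp only [this]

/-! ### Convolution operators and the absorbing state. -/

namespace CompactQuantumGroup

open MinTensor

variable (G : CompactQuantumGroup.{u})

/-- Convolution by a functional on the right leg, `(id ⊗ f) ∘ Δ`. -/
def convRight (f : G.C →L[ℂ] ℂ) : G.C →L[ℂ] G.C := sliceRight G.C f ∘L G.Δ.toCLM

/-- Convolution by a functional on the left leg, `(f ⊗ id) ∘ Δ`. -/
def convLeft (f : G.C →L[ℂ] ℂ) : G.C →L[ℂ] G.C := sliceLeft G.C f ∘L G.Δ.toCLM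

theorem convRight_apply (f : G.C →L[ℂ] ℂ) (a : G.C) :
    G.convRight f a = sliceRight G.C f (G.Δ a) := rfl

theorem convLeft_apply (f : G.C →L[ℂ] ℂ) (a : G.C) :
    G.convLeft f a = sliceLeft G.C f (G.Δ a) := rfl

variable {G}

theorem convRight_one {f : G.C →L[ℂ] ℂ} (hf : IsState f) : G.convRight f 1 = 1 := by
  rw [convRight_apply, map_one, sliceRight_one hf]

theorem convLeft_one {f : G.C →L[ℂ] ℂ} (hf : IsState f) : G.convLeft f 1 = 1 := by
  rw [convLeft_apply, map_one, sliceLeft_one hf]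

theorem norm_convRight_le {f : G.C →L[ℂ] ℂ} (hf : IsState f) (a : G.C) :
    ‖G.convRight f a‖ ≤ ‖a‖ :=
  (norm_sliceRight_le hf _).trans (NonUnitalStarAlgHom.norm_apply_le G.Δ a)

theorem norm_convLeft_le {f : G.C →L[ℂ] ℂ} (hf : IsState f) (a : G.C) :
    ‖G.convLeft f a‖ ≤ ‖a‖ :=
  (norm_sliceLeft_le hf _).trans (NonUnitalStarAlgHom.norm_apply_le G.Δ a)

theorem convLeft_convRight {f g : G.C →L[ℂ] ℂ} (hf : IsVectorFunctional f)
    (hg : IsVectorFunctional g) (a : G.C) :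
    G.convLeft g (G.convRight f a) = G.convRight f (G.convLeft g a) := by
  rw [convLeft_apply, convRight_apply, convRight_apply, convLeft_apply, ← sliceRight_map_id hf,
    ← sliceLeft_id_map hg]
  refine (G.coassoc a).apply_eq (sliceLeft G.C g ∘L sliceRight (MinTensor G.C G.C) f)
    (sliceRight G.C f ∘L sliceLeft (MinTensor G.C G.C) g) fun x y z => ?_
  simp only [ContinuousLinearMap.comp_apply, sliceRight_tmul hf, sliceLeft_tmul hg, map_smul]
  exact smul_comm _ _ _

/-- The functional `g ∘L G.convLeft f` is the convolution (f ⊗ g)Δ, so this is coassociativity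
sliced by g and f on the last two legs. -/
theorem convRight_convRight {f g : G.C →L[ℂ] ℂ} (hf : IsState f) (hg : IsState g) (a : G.C) :
    G.convRight f (G.convRight g a) = G.convRight (g ∘L G.convLeft f) a := by
  have hs : IsState (g ∘L sliceLeft G.C f) := hg.comp (sliceLeft_one hf) (norm_sliceLeft_le hf)
  have hs' : IsState (g ∘L G.convLeft f) := hg.comp (convLeft_one hf) (norm_convLeft_le hf)
  have e : G.convRight (g ∘L G.convLeft f) a =
      sliceRight G.C (g ∘L sliceLeft G.C f) (map (StarAlgHom.id ℂ G.C) G.Δ (G.Δ a)) :=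
    (sliceRight_id_map hs.isVectorFunctional G.Δ hs'.isVectorFunctional (G.Δ a)).symm
  rw [e, convRight_apply, convRight_apply, ← sliceRight_map_id hg.isVectorFunctional]
  refine (G.coassoc a).apply_eq (sliceRight G.C f ∘L sliceRight (MinTensor G.C G.C) g) _
    fun x y z => ?_
  have e' : (g ∘L sliceLeft G.C f) (tmul y z) = f y * g z := by
    rw [ContinuousLinearMap.comp_apply, sliceLeft_tmul hf.isVectorFunctional, map_smul, smul_eq_mul]
  rw [ContinuousLinearMap.comp_apply, sliceRight_tmul hg.isVectorFunctional, map_smul,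
    sliceRight_tmul hf.isVectorFunctional, sliceRight_tmul hs.isVectorFunctional, e', smul_smul,
    mul_comm]

/-- Taking adjoints turns the density of the span of Δ(a)(b ⊗ 1) into that of the span of (b ⊗
1)Δ(a), the order suited to functionals of the form h(c ·). -/
theorem clm_ext_dense_left {E : Type*} [NormedAddCommGroup E] [NormedSpace ℂ E]
    {f g : MinTensor G.C G.C →L[ℂ] E} (h : ∀ a b, f (tmul b 1 * G.Δ a) = g (tmul b 1 * G.Δ a))
    (x : MinTensor G.C G.C) : f x = g x := by
  have hcl : IsClosed {x : MinTensor G.C G.C | f (star x) = g (star x)} :=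
    isClosed_eq (f.continuous.comp continuous_star) (g.continuous.comp continuous_star)
  have hmem : star x ∈ {x : MinTensor G.C G.C | f (star x) = g (star x)} := by
    refine closure_minimal (fun y hy => ?_) hcl (G.dense_left (star x))
    induction hy using Submodule.span_induction with
    | mem y hy =>
      obtain ⟨a, b, rfl⟩ := hy
      rw [Set.mem_ofPred_eq, star_mul, ← map_star, star_tmul, star_one]
      exact h _ _
    | zero => simp
    | add y z _ _ hy hz =>
      rw [Set.mem_ofPred_eq] at hy hz ⊢
      rw [star_add, map_add, map_add, hy, hz]
    | smul c y _ hy =>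
      rw [Set.mem_ofPred_eq] at hy ⊢
      rw [star_smul, map_smul, map_smul, hy]
  rw [Set.mem_ofPred_eq, star_star] at hmem
  exact hmem

/-- For a state `φ` there is a state `h` such that `ρ * h = ρ(1) h` for all functionals
`ρ = φ(s ·)`. -/
theorem exists_absorbing_state {φ : G.C →L[ℂ] ℂ} (hφ : IsState φ) :
    ∃ h : G.C →L[ℂ] ℂ, IsState h ∧ ∀ s d, φ (s * G.convRight h d) = φ s * h d := by
  -- Averaging on one side and then on the other gives φ ∗ h = h = h ∗ φ: the two convolution
  -- operators commute, so the second average keeps the first invariance.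
  obtain ⟨h₁, hh₁, hL₁, -⟩ := hφ.exists_invariant (convLeft_one hφ) (norm_convLeft_le hφ)
  obtain ⟨h, hh, hR, hcomm⟩ := hh₁.exists_invariant (convRight_one hφ) (norm_convRight_le hφ)
  have hL : ∀ a, h (G.convLeft φ a) = h a := hcomm _
    (convLeft_convRight hφ.isVectorFunctional hφ.isVectorFunctional) hL₁
  have hφv := hφ.isVectorFunctional
  have hhv := hh.isVectorFunctional
  refine ⟨h, hh, fun s d => ?_⟩
  have fixed : ∀ d, G.convRight φ (G.convRight h d) = G.convRight h d := fun d => by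
    rw [convRight_convRight hφ hh, show h ∘L G.convLeft φ = h from ContinuousLinearMap.ext hL]
  -- The product state h ⊗ φ.
  let g : MinTensor G.C G.C →L[ℂ] ℂ := h ∘L sliceRight G.C φ
  have hg : IsState g := hh.comp (sliceRight_one hφ) (norm_sliceRight_le hφ)
  have gtmul : ∀ a b, g (tmul a b) = φ b * h a := fun a b => by
    simp only [g, ContinuousLinearMap.comp_apply, sliceRight_tmul hφv, map_smul, smul_eq_mul]
  have gmul : ∀ c s y, g (tmul c s * y) =
      h (c * sliceRight G.C (φ ∘L ContinuousLinearMap.mul ℂ G.C s) y) := fun c s y => by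
    simp only [g, ContinuousLinearMap.comp_apply, sliceRight_tmul_mul hφv]
  have mul_one_eq : φ ∘L ContinuousLinearMap.mul ℂ G.C 1 = φ :=
    ContinuousLinearMap.ext fun a => congrArg φ (one_mul a)
  have key : ∀ c d, φ (s * G.convRight h (sliceLeft G.C h (tmul c 1 * G.Δ d))) =
      φ s * h (sliceLeft G.C h (tmul c 1 * G.Δ d)) := fun c d => by
    set b := G.convRight h d with hb
    have h1 : g (tmul (star b) 1 * G.Δ b) = h (star b * b) := by
      rw [gmul, mul_one_eq, ← convRight_apply, fixed]
    -- Invariance makes all four terms of the expanded square equal to h(b*b) up to sign.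
    -- Cauchy–Schwarz then allows Δ(b) to be replaced by b ⊗ 1 under g, after any left factor c ⊗ s.
    have h2 : g (star (G.Δ b - tmul b 1) * (G.Δ b - tmul b 1)) = 0 := by
      have e : star (G.Δ b - tmul b 1) * (G.Δ b - tmul b 1) = G.Δ (star b * b)
          - star (tmul (star b) 1 * G.Δ b) - tmul (star b) 1 * G.Δ b + tmul (star b * b) 1 := by
        rw [star_sub, star_mul, star_tmul, star_tmul, star_star, star_one, map_mul, map_star,
          ← one_mul (1 : G.C), ← tmul_mul_tmul, one_mul]
        noncomm_ring
      rw [e, map_add, map_sub, map_sub, hg.apply_star, h1, gtmul, hφ.apply_one, one_mul,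
        ← hh.apply_star, star_mul, star_star]
      have : g (G.Δ (star b * b)) = h (star b * b) := hR _
      rw [this]
      ring
    have h3 := hg.apply_mul_eq_zero h2 (tmul c s)
    rw [mul_sub, map_sub, tmul_mul_tmul, mul_one, gtmul, gmul, sub_eq_zero] at h3
    have hc := hhv.comp_mul c
    have e1 : h (c * sliceRight G.C (φ ∘L ContinuousLinearMap.mul ℂ G.C s) (G.Δ b)) =
        φ (s * G.convLeft (h ∘L ContinuousLinearMap.mul ℂ G.C c) b) :=
      apply_sliceRight hc (hφv.comp_mul s) (G.Δ b)
    have e2 : h (c * b) = h (G.convLeft (h ∘L ContinuousLinearMap.mul ℂ G.C c) d) :=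
      apply_sliceRight hc hhv (G.Δ d)
    rw [e1, e2, hb, convLeft_convRight hhv hc] at h3
    rw [sliceLeft_tmul_mul hhv, one_mul]
    exact h3
  -- The identity is known at slices of (c ⊗ 1)Δ(d), which span a dense subspace of arguments. By
  -- continuity it holds at the slice of 1 ⊗ d, which is d itself.
  have all := clm_ext_dense_left
    (f := φ ∘L ContinuousLinearMap.mul ℂ G.C s ∘L G.convRight h ∘L sliceLeft G.C h)
    (g := φ s • h ∘L sliceLeft G.C h) (fun d c => key c d) (tmul 1 d)
  have e : sliceLeft G.C h (tmul 1 d) = d := by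
    rw [sliceLeft_tmul hhv, hh.apply_one, one_smul]
  simp only [ContinuousLinearMap.comp_apply, smul_apply, e] at all
  exact all

end CompactQuantumGroup

/-! ### Actions on finite spaces are given by magic unitaries -/

theorem IsState.exists_nonneg {A : Type u} [CStarAlgebra A] {f : A →L[ℂ] ℂ} (hf : IsState f)
    (x : A) : ∃ r : ℝ, 0 ≤ r ∧ f (star x * x) = r := by
  obtain ⟨π, ξ, -, h⟩ := hf.exists_rep
  refine ⟨‖π.hom x ξ‖ ^ 2, by positivity, ?_⟩
  rw [h, map_mul, mul_apply_eq_comp, ← π.inner_hom_left, inner_self_eq_norm_sq_to_K]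
  simp

namespace FinSpace

variable {X : Type v} [DecidableEq X]

/-- The matrix coefficients of a map `α : C(X) → C(X) ⊗ B`. -/
def coeff {B : Type u} (α : (X → ℂ) → (X → B)) (x y : X) : B := α (Pi.single y 1) x

theorem apply_eq_sum_coeff [Fintype X] {B : Type u} [CStarAlgebra B] (α : (X → ℂ) →ₗ[ℂ] (X → B)) (f : X → ℂ)
    (x : X) : α f x = ∑ y, f y • coeff α x y := by
  conv_lhs => rw [pi_eq_sum_univ' f, map_sum, Finset.sum_apply]
  refine Finset.sum_congr rfl fun y _ => ?_
  rw [map_smul]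
  refine congrArg (fun g => f y • α g x) (funext fun z => ?_)
  simp [Pi.single_apply]

section hom

variable {B : Type u} [CStarAlgebra B] (α : (X → ℂ) →⋆ₐ[ℂ] (X → B))

theorem star_coeff (x y : X) : star (coeff α x y) = coeff α x y := by
  show star (α (Pi.single y 1)) x = _
  rw [← map_star]
  refine congrArg (fun g => α g x) ?_
  rw [← Pi.single_star, star_one]

theorem coeff_mul_coeff (x y z : X) :
    coeff α x y * coeff α x z = if y = z then coeff α x y else 0 := by
  show (α (Pi.single y 1) * α (Pi.single z 1)) x = _
  rw [← map_mul]
  split_ifs with h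
  · subst h
    rw [← Pi.single_mul, one_mul]; rfl
  · have : (Pi.single y 1 * Pi.single z 1 : X → ℂ) = 0 := by
      funext t
      by_cases ht : t = y
      · subst ht; simp [h]
      · simp [Pi.single_apply, ht]
    rw [this, map_zero]; rfl

theorem sum_coeff [Fintype X] (x : X) : ∑ y, coeff α x y = 1 := by
  have := apply_eq_sum_coeff α.toAlgHom.toLinearMap 1 x
  simp only [Pi.one_apply, one_smul] at this
  refine this.symm.trans ?_
  exact congrFun (map_one α) x

end hom

variable [Fintype X]

theorem Coassociative.comul_coeff {G : CompactQuantumGroup.{u}} {α : (X → ℂ) →ₗ[ℂ] (X → G.C)}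
    (h : Coassociative G α) (x y : X) :
    G.Δ (coeff α x y) = ∑ z, MinTensor.tmul (coeff α x z) (coeff α z y) :=
  (congrFun (h (Pi.single y 1)) x).symm

section magic

variable {G : CompactQuantumGroup.{u}} {q : X → X → G.C}

open CompactQuantumGroup MinTensor

omit [DecidableEq X] in
theorem convRight_sum_mul {h : G.C →L[ℂ] ℂ} (hh : IsState h)
    (hΔ : ∀ x y, G.Δ (q x y) = ∑ z, MinTensor.tmul (q x z) (q z y)) (x x' : X) :
    G.convRight h (∑ y, q x y * q x' y) =
      ∑ z, ∑ z', h (∑ y, q z y * q z' y) • (q x z * q x' z') := by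
  have e : G.Δ (∑ y, q x y * q x' y) =
      ∑ z, ∑ z', MinTensor.tmul (q x z * q x' z') (∑ y, q z y * q z' y) := by
    have ts : ∀ (a : G.C) (f : X → G.C), MinTensor.tmul a (∑ y, f y) =
        ∑ y, MinTensor.tmul a (f y) := fun a f => map_sum (tmulBilin _ _ a) f Finset.univ
    have tm : ∀ y, G.Δ (q x y * q x' y) =
        ∑ z, ∑ z', MinTensor.tmul (q x z * q x' z') (q z y * q z' y) := fun y => by
      rw [map_mul, hΔ, hΔ]
      refine (Finset.sum_mul_sum _ _ _ _).trans ?_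
      exact Finset.sum_congr rfl fun z _ => Finset.sum_congr rfl fun z' _ => tmul_mul_tmul _ _ _ _
    simp only [ts, map_sum, tm]
    rw [Finset.sum_comm]
    exact Finset.sum_congr rfl fun z _ => Finset.sum_comm
  rw [convRight_apply, e, map_sum]
  refine Finset.sum_congr rfl fun z _ => ?_
  rw [map_sum]
  exact Finset.sum_congr rfl fun z' _ => sliceRight_tmul hh.isVectorFunctional _ _

/-- If the product is nonzero, a state φ is chosen that is supported on q_x'y and charges q_xy.
Absorption forces h to be 1 on ∑_z q_xz q_x'z, that is, rows x and x' agree h-almost surely. The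
Podleś condition then fails to separate x from x'. -/
theorem coeff_col_orthogonal (hstar : ∀ x y, star (q x y) = q x y)
    (hrow : ∀ x y z, q x y * q x z = if y = z then q x y else 0) (hsum : ∀ x, ∑ y, q x y = 1)
    (hΔ : ∀ x y, G.Δ (q x y) = ∑ z, MinTensor.tmul (q x z) (q z y))
    (hP : Dense (Submodule.span ℂ {F : X → G.C | ∃ (f : X → ℂ) (c : G.C),
      F = fun x => (∑ y, f y • q x y) * c} : Set (X → G.C)))
    {x x' : X} (hx : x ≠ x') (y : X) : q x y * q x' y = 0 := by
  by_contra hne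
  obtain ⟨π, ξ, -, hξ⟩ := IsState.exists_rep_norm_eq (q x y * q x' y)
  have hξ' : π.hom (q x y) (π.hom (q x' y) ξ) ≠ 0 := by
    rw [← mul_apply_eq_comp, ← map_mul, ← norm_pos_iff, hξ, norm_pos_iff]
    exact hne
  set η₀ := π.hom (q x' y) ξ with hη₀
  have hη₀0 : η₀ ≠ 0 := fun h => hξ' (by rw [h, map_zero])
  set η := ((‖η₀‖⁻¹ : ℝ) : ℂ) • η₀ with hη
  have hcoef : ((‖η₀‖⁻¹ : ℝ) : ℂ) ≠ 0 := by simpa using hη₀0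
  have hη1 : ‖η‖ = 1 := by
    rw [hη, norm_smul, Complex.norm_real, norm_inv, norm_norm, inv_mul_cancel₀]
    exact norm_ne_zero_iff.mpr hη₀0
  have hfix : π.hom (q x' y) η = η := by
    rw [hη, map_smul, hη₀, ← mul_apply_eq_comp, ← map_mul, hrow, if_pos rfl]
  -- The vector state at η, a unit vector fixed by q_x'y and not killed by q_xy.
  let φ : G.C →L[ℂ] ℂ := innerSL ℂ η ∘L ContinuousLinearMap.apply ℂ π.H η ∘L π.hom.toCLM
  have hφ_apply : ∀ a, φ a = Inner.inner ℂ η (π.hom a η) := fun a => rfl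
  have hφ : IsState φ := IsState.of_rep π hη1 hφ_apply
  have hφmul : ∀ a, φ (a * q x' y) = φ a := fun a => by
    rw [hφ_apply, map_mul, mul_apply_eq_comp, hfix, hφ_apply]
  have hφq : φ (q x y) ≠ 0 := by
    have e : φ (q x y) = Inner.inner ℂ (π.hom (q x y) η) (π.hom (q x y) η) := by
      rw [π.inner_hom_left, hstar, ← mul_apply_eq_comp, ← map_mul, hrow, if_pos rfl]; rfl
    rw [e, inner_self_ne_zero, hη, map_smul]
    exact smul_ne_zero hcoef hξ'
  obtain ⟨h, hh, habs⟩ := exists_absorbing_state hφ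
  have hd : h (∑ z, q x z * q x' z) = 1 := by
    have h1 := habs (q x y) (∑ z, q x z * q x' z)
    -- In the double sum over (z, z'), the left factor q_xy kills all z ≠ y, and φ = φ(· q_x'y)
    -- kills all z' ≠ y. The remaining term has coefficient h(∑_w q_yw q_yw) = h(1) = 1.
    rw [convRight_sum_mul hh hΔ, Finset.mul_sum, map_sum, Finset.sum_eq_single y] at h1
    · rw [Finset.mul_sum, map_sum, Finset.sum_eq_single y] at h1
      · rw [mul_smul_comm, map_smul, ← mul_assoc, hrow, if_pos rfl, hφmul, smul_eq_mul] at h1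
        simp only [hrow, if_true, hsum, hh.apply_one, one_mul] at h1
        exact (mul_left_cancel₀ hφq ((mul_one _).trans h1)).symm
      · intro z _ hz
        rw [mul_smul_comm, map_smul, ← hφmul, mul_assoc, mul_assoc, hrow, if_neg hz, mul_zero,
          mul_zero, map_zero, smul_zero]
      · exact fun hy => absurd (Finset.mem_univ y) hy
    · intro z _ hz
      rw [Finset.mul_sum, map_sum]
      refine Finset.sum_eq_zero fun z' _ => ?_
      rw [mul_smul_comm, map_smul, ← mul_assoc, hrow, if_neg (Ne.symm hz), zero_mul, map_zero,
        smul_zero]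
    · exact fun hy => absurd (Finset.mem_univ y) hy
  have hsa : ∀ z, star (q x z - q x' z) = q x z - q x' z := fun z => by
    rw [star_sub, hstar, hstar]
  have hzero : ∑ z, h (star (q x z - q x' z) * (q x z - q x' z)) = 0 := by
    have hd' : h (∑ z, q x' z * q x z) = 1 := by
      have : ∑ z, q x' z * q x z = star (∑ z, q x z * q x' z) := by
        rw [star_sum]
        exact Finset.sum_congr rfl fun z _ => by rw [star_mul, hstar, hstar]
      rw [this, hh.apply_star, hd, star_one]
    have e : ∀ z, star (q x z - q x' z) * (q x z - q x' z) =
        q x z - q x z * q x' z - q x' z * q x z + q x' z := fun z => by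
      have h1 := hrow x z z
      have h2 := hrow x' z z
      rw [if_pos rfl] at h1 h2
      rw [hsa, sub_mul, mul_sub, mul_sub, h1, h2]
      abel
    simp only [e]
    rw [← map_sum, Finset.sum_add_distrib, Finset.sum_sub_distrib, Finset.sum_sub_distrib, hsum,
      hsum, map_add, map_sub, map_sub, hd, hd', hh.apply_one]
    ring
  have hterm : ∀ z, h (star (q x z - q x' z) * (q x z - q x' z)) = 0 := by
    choose r hr hr' using fun z => hh.exists_nonneg (q x z - q x' z)
    simp only [hr'] at hzero ⊢
    intro z
    rw [← Complex.ofReal_sum, Complex.ofReal_eq_zero] at hzero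
    rw [(Finset.sum_eq_zero_iff_of_nonneg fun z _ => hr z).mp hzero z (Finset.mem_univ z)]
    rfl
  have hmul : ∀ z c, h ((q x z - q x' z) * c) = 0 := fun z c => by
    rw [← star_star ((q x z - q x' z) * c), star_mul, hsa, hh.apply_star,
      hh.apply_mul_eq_zero (hterm z), star_zero]
  -- All the α(f)(1 ⊗ c) lie in this closed subspace, but δ_x ⊗ 1 does not.
  have hcl : IsClosed {F : X → G.C | h (F x) - h (F x') = 0} :=
    isClosed_eq ((h.continuous.comp (continuous_apply x)).sub
      (h.continuous.comp (continuous_apply x'))) continuous_const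
  have hall : (Pi.single x 1 : X → G.C) ∈ {F : X → G.C | h (F x) - h (F x') = 0} := by
    refine closure_minimal (fun F hF => ?_) hcl (hP _)
    induction hF using Submodule.span_induction with
    | mem F hF =>
      obtain ⟨f, c, rfl⟩ := hF
      rw [Set.mem_ofPred_eq, ← map_sub, ← sub_mul, ← Finset.sum_sub_distrib, Finset.sum_mul, map_sum]
      refine Finset.sum_eq_zero fun z _ => ?_
      rw [← smul_sub, smul_mul_assoc, map_smul, hmul, smul_zero]
    | zero => simp
    | add F F' _ _ hF hF' =>
      rw [Set.mem_ofPred_eq] at hF hF' ⊢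
      rw [Pi.add_apply, Pi.add_apply, map_add, map_add, add_sub_add_comm, hF, hF', add_zero]
    | smul c F _ hF =>
      rw [Set.mem_ofPred_eq] at hF ⊢
      rw [Pi.smul_apply, Pi.smul_apply, map_smul, map_smul, ← smul_sub, hF, smul_zero]
  rw [Set.mem_ofPred_eq, Pi.single_eq_same, Pi.single_eq_of_ne (Ne.symm hx), map_zero, sub_zero,
    hh.apply_one] at hall
  exact one_ne_zero hall

end magic

/-- Each defect 1 - ∑_x q_xy is a projection, hence positive. The defects add up to zero because the
matrix is square and its rows sum to 1. -/
theorem sum_col_eq_one {B : Type u} [CStarAlgebra B] {q : X → X → B}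
    (hstar : ∀ x y, star (q x y) = q x y) (hsum : ∀ x, ∑ y, q x y = 1)
    (hcol : ∀ x x' y, q x y * q x' y = if x = x' then q x y else 0) (y : X) :
    ∑ x, q x y = 1 := by
  let _ := CStarAlgebra.spectralOrder B
  have := CStarAlgebra.spectralOrderedRing B
  have hnn : ∀ y, 0 ≤ 1 - ∑ x, q x y := fun y => by
    have hp : (∑ x, q x y) * (∑ x, q x y) = ∑ x, q x y := by
      rw [Finset.sum_mul_sum]
      exact Finset.sum_congr rfl fun x _ => by simp [hcol]
    have hs : star (∑ x, q x y) = ∑ x, q x y := by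
      rw [star_sum]; exact Finset.sum_congr rfl fun x _ => hstar x y
    have e : 1 - ∑ x, q x y = star (1 - ∑ x, q x y) * (1 - ∑ x, q x y) := by
      rw [star_sub, star_one, hs, sub_mul, mul_sub, mul_sub, hp, one_mul, mul_one, one_mul, sub_self,
        sub_zero]
    rw [e]
    exact star_mul_self_nonneg _
  have hz : ∑ y, (1 - ∑ x, q x y) = 0 := by
    rw [Finset.sum_sub_distrib, Finset.sum_comm]
    simp only [hsum]
    exact sub_self _
  have := (Finset.sum_eq_zero_iff_of_nonneg fun y _ => hnn y).mp hz y (Finset.mem_univ y)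
  exact (sub_eq_zero.mp this).symm

theorem IsAction.coeff_mul_coeff_col {G : CompactQuantumGroup.{u}}
    {α : (X → ℂ) →⋆ₐ[ℂ] (X → G.C)} (h : IsAction G α) (x x' y : X) :
    coeff α x y * coeff α x' y = if x = x' then coeff α x y else 0 := by
  split_ifs with hx
  · subst hx
    rw [coeff_mul_coeff, if_pos rfl]
  · refine coeff_col_orthogonal (star_coeff α) (coeff_mul_coeff α) (sum_coeff α)
      h.coassoc.comul_coeff ?_ hx y
    have e : {F : X → G.C | ∃ (f : X → ℂ) (c : G.C),
        F = fun x => (∑ y, f y • coeff α x y) * c} =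
        {F | ∃ (f : X → ℂ) (c : G.C), F = α.toAlgHom.toLinearMap f * tmul 1 c} := by
      refine Set.ext fun F => exists_congr fun f => exists_congr fun c => ?_
      have : (fun x => (∑ y, f y • coeff α x y) * c) = α.toAlgHom.toLinearMap f * tmul 1 c := by
        funext x
        rw [Pi.mul_apply, apply_eq_sum_coeff, tmul, Pi.one_apply, one_smul]
        rfl
      rw [this]
    rw [e]
    exact h.podles

theorem IsAction.sum_coeff_col {G : CompactQuantumGroup.{u}}
    {α : (X → ℂ) →⋆ₐ[ℂ] (X → G.C)} (h : IsAction G α) (y : X) : ∑ x, coeff α x y = 1 :=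
  sum_col_eq_one (star_coeff α) (sum_coeff α) h.coeff_mul_coeff_col y

end FinSpace

namespace DirectedGraph

variable {V : Type v} {E : Type w} [Fintype V] [DecidableEq V] [Fintype E] [DecidableEq E]
  {𝒢 : DirectedGraph V E}

open FinSpace

/-! ### Objects of the category give solutions of Bichon's relations -/

namespace BicObj

variable (X : BicObj.{u} 𝒢)

theorem exists_starAlgHom_lam : ∃ L : (E → ℂ) →⋆ₐ[ℂ] (E → X.G.C), coeff L = coeff X.lam := by
  obtain ⟨L, hL, -⟩ := X.isAction_lam
  exact ⟨L, funext fun e => funext fun f => congrFun (hL _) e⟩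

theorem star_coeff_lam (e f : E) : star (coeff X.lam e f) = coeff X.lam e f := by
  obtain ⟨L, hL⟩ := X.exists_starAlgHom_lam
  rw [← hL, star_coeff]

theorem coeff_lam_mul_self (e f : E) : coeff X.lam e f * coeff X.lam e f = coeff X.lam e f := by
  obtain ⟨L, hL⟩ := X.exists_starAlgHom_lam
  rw [← hL, coeff_mul_coeff, if_pos rfl]

theorem sum_coeff_lam (e : E) : ∑ f, coeff X.lam e f = 1 := by
  obtain ⟨L, hL⟩ := X.exists_starAlgHom_lam
  rw [← hL, sum_coeff]

theorem coeff_lam_mul_coeff (e f : E) (w : V) :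
    coeff X.lam e f * coeff X.α (𝒢.r e) w = if 𝒢.r f = w then coeff X.lam e f else 0 := by
  refine (congrFun (X.isEquivariant.map_rightAct (Pi.single f 1) (Pi.single w 1)) e).symm.trans ?_
  have : 𝒢.rightAct (Pi.single f 1 : E → ℂ) (Pi.single w 1) =
      if 𝒢.r f = w then Pi.single f 1 else 0 := by
    funext g
    by_cases hg : g = f
    · subst hg
      by_cases h : 𝒢.r g = w <;> simp [rightAct, h]
    · split_ifs <;> simp [rightAct, hg]
  rw [this]
  split_ifs
  · rfl
  · rw [map_zero]; rfl

theorem coeff_mul_coeff_lam (e f : E) (v : V) :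
    coeff X.α (𝒢.s e) v * coeff X.lam e f = if 𝒢.s f = v then coeff X.lam e f else 0 := by
  refine (congrFun (X.isEquivariant.map_leftAct (Pi.single v 1) (Pi.single f 1)) e).symm.trans ?_
  have : 𝒢.leftAct (Pi.single v 1 : V → ℂ) (Pi.single f 1) =
      if 𝒢.s f = v then Pi.single f 1 else 0 := by
    funext g
    by_cases hg : g = f
    · subst hg
      by_cases h : 𝒢.s g = v <;> simp [leftAct, h]
    · split_ifs <;> simp [leftAct, hg]
  rw [this]
  split_ifs
  · rfl
  · rw [map_zero]; rfl

/-- Compatibility with the inner product at ξ = η = δ_f. The coefficients of λ are projections, so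
the squares in the inner product disappear. -/
theorem sum_coeff_lam_range (v : V) (f : E) :
    ∑ e with 𝒢.r e = v, coeff X.lam e f = coeff X.α v (𝒢.r f) := by
  have h := congrFun (X.isEquivariant.innerProd_map (Pi.single f 1) (Pi.single f 1)) v
  have e1 : 𝒢.innerProd (X.lam (Pi.single f 1)) (X.lam (Pi.single f 1)) v =
      ∑ e with 𝒢.r e = v, coeff X.lam e f := by
    refine Finset.sum_congr rfl fun e _ => ?_
    exact (congrArg (· * coeff X.lam e f) (X.star_coeff_lam e f)).trans (X.coeff_lam_mul_self e f)
  have e2 : 𝒢.innerProd (Pi.single f 1 : E → ℂ) (Pi.single f 1) = Pi.single (𝒢.r f) 1 := by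
    funext w
    rw [innerProd, Finset.sum_filter, Finset.sum_eq_single f]
    · by_cases hw : 𝒢.r f = w
      · subst hw; simp
      · simp [hw, Ne.symm hw]
    · intro e _ he; simp [he]
    · exact fun hf => absurd (Finset.mem_univ f) hf
  rw [e1, e2] at h
  exact h

/-- The left and right module conditions say that λ_ef absorbs α_{s(e)s(f)} and α_{r(e)r(f)} and is
orthogonal to the other entries of those rows. Insert ∑_f λ_ef = 1 between the two factors. -/
theorem coeff_source_mul_coeff_range (e : E) (v w : V) :
    coeff X.α (𝒢.s e) v * coeff X.α (𝒢.r e) w =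
      ∑ f, if 𝒢.s f = v ∧ 𝒢.r f = w then coeff X.lam e f else 0 := by
  rw [← mul_one (coeff X.α (𝒢.s e) v), ← X.sum_coeff_lam e, Finset.mul_sum, Finset.sum_mul]
  refine Finset.sum_congr rfl fun f _ => ?_
  rw [coeff_mul_coeff_lam]
  split_ifs with h1 h2 h2
  · rw [coeff_lam_mul_coeff, if_pos h2.2]
  · rw [coeff_lam_mul_coeff, if_neg fun h => h2 ⟨h1, h⟩]
  · exact absurd h2.1 h1
  · rw [zero_mul]

theorem coeff_range_mul_coeff_source (e : E) (v w : V) :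
    coeff X.α (𝒢.r e) w * coeff X.α (𝒢.s e) v =
      coeff X.α (𝒢.s e) v * coeff X.α (𝒢.r e) w := by
  have h := congrArg star (X.coeff_source_mul_coeff_range e v w)
  rw [star_mul, star_coeff, star_coeff] at h
  rw [h, coeff_source_mul_coeff_range, star_sum]
  refine Finset.sum_congr rfl fun f _ => ?_
  split_ifs
  · exact X.star_coeff_lam e f
  · exact star_zero _

theorem coeff_lam (h𝒢 : 𝒢.IsSimple) (e f : E) :
    coeff X.lam e f = coeff X.α (𝒢.s e) (𝒢.s f) * coeff X.α (𝒢.r e) (𝒢.r f) := by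
  rw [coeff_source_mul_coeff_range, Finset.sum_eq_single f]
  · rw [if_pos ⟨rfl, rfl⟩]
  · exact fun g _ hg => if_neg fun h => hg (h𝒢.no_multiple_edges g f h.1 h.2)
  · exact fun hf => absurd (Finset.mem_univ f) hf

theorem bichonRelations : 𝒢.BichonRelations (coeff X.α) where
  star_eq := star_coeff X.α
  row u v w := coeff_mul_coeff X.α v w u
  col u v w := X.isAction.coeff_mul_coeff_col v u w
  sum_row := sum_coeff X.α
  sum_col := X.isAction.sum_coeff_col
  edge_left e v w hvw := by
    have h : coeff X.α (𝒢.s e) v * coeff X.α (𝒢.r e) w = 0 := by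
      rw [coeff_source_mul_coeff_range]
      exact Finset.sum_eq_zero fun f _ => if_neg fun h => hvw ⟨f, h⟩
    exact ⟨h, by rw [coeff_range_mul_coeff_source, h]⟩
  edge_right e v w hvw := by
    have h : coeff X.α v (𝒢.s e) * coeff X.α w (𝒢.r e) = 0 := by
      -- The second factor is the sum of λ_ge over the edges g into w, and λ_ge = α_{s(g)s(e)} λ_ge.
      -- Column orthogonality kills each term, since v = s(g) would make g an edge from v to w.
      rw [← sum_coeff_lam_range, Finset.mul_sum]
      refine Finset.sum_eq_zero fun g hg => ?_
      have hgw := (Finset.mem_filter.mp hg).2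
      have e1 := X.coeff_mul_coeff_lam g e (𝒢.s e)
      rw [if_pos rfl] at e1
      rw [← e1, ← mul_assoc, X.isAction.coeff_mul_coeff_col,
        if_neg fun h => hvw ⟨g, h.symm, hgw⟩, zero_mul]
    refine ⟨h, ?_⟩
    have h' := congrArg star h
    rwa [star_mul, star_coeff, star_coeff, star_zero] at h'
  comm e f := (X.coeff_range_mul_coeff_source e (𝒢.s f) (𝒢.r f)).symm

end BicObj

end DirectedGraph

/-! ### Actions defined by magic unitaries -/

namespace FinSpace

variable {X : Type v} [Fintype X] [DecidableEq X]

/-- The `*`-homomorphism `C(X) → C(X) ⊗ B` with matrix coefficients `q`. -/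
def ofCoeff {B : Type u} [CStarAlgebra B] (q : X → X → B) (hstar : ∀ x y, star (q x y) = q x y)
    (hrow : ∀ x y z, q x y * q x z = if y = z then q x y else 0) (hsum : ∀ x, ∑ y, q x y = 1) :
    (X → ℂ) →⋆ₐ[ℂ] (X → B) where
  toFun f x := ∑ y, f y • q x y
  map_one' := by
    funext x
    simp only [Pi.one_apply, one_smul, hsum]
  map_mul' f g := by
    funext x
    rw [Pi.mul_apply, Finset.sum_mul_sum]
    refine Finset.sum_congr rfl fun y _ => ?_
    rw [Finset.sum_eq_single y]
    · rw [smul_mul_smul_comm, hrow, if_pos rfl, Pi.mul_apply]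
    · intro z _ hz
      rw [smul_mul_smul_comm, hrow, if_neg (Ne.symm hz), smul_zero]
    · exact fun hy => absurd (Finset.mem_univ y) hy
  map_zero' := by
    funext x
    simp
  map_add' f g := by
    funext x
    simp [add_smul, Finset.sum_add_distrib]
  commutes' c := by
    funext x
    simp only [Pi.algebraMap_apply, Algebra.algebraMap_self, RingHom.id_apply]
    rw [← Finset.smul_sum, hsum, Algebra.algebraMap_eq_smul_one]
  map_star' f := by
    funext x
    rw [Pi.star_apply, star_sum]
    refine Finset.sum_congr rfl fun y _ => ?_
    rw [star_smul, hstar]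
    rfl

theorem ofCoeff_apply {B : Type u} [CStarAlgebra B] {q : X → X → B} (hstar hrow hsum) (f : X → ℂ)
    (x : X) : ofCoeff q hstar hrow hsum f x = ∑ y, f y • q x y := rfl

theorem coeff_ofCoeff {B : Type u} [CStarAlgebra B] {q : X → X → B} (hstar hrow hsum) :
    coeff (ofCoeff q hstar hrow hsum) = q := by
  funext x y
  rw [coeff, ofCoeff_apply, Finset.sum_eq_single y]
  · simp
  · intro z _ hz; simp [hz]
  · exact fun hy => absurd (Finset.mem_univ y) hy

theorem isAction_ofCoeff {G : CompactQuantumGroup.{u}} {q : X → X → G.C} (hstar hrow hsum)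
    (hcol : ∀ x x' y, q x y * q x' y = if x = x' then q x y else 0)
    (hΔ : ∀ x y, G.Δ (q x y) = ∑ z, MinTensor.tmul (q x z) (q z y)) :
    IsAction G (ofCoeff q hstar hrow hsum) where
  coassoc f := by
    have hc : ∀ x y, (ofCoeff q hstar hrow hsum).toAlgHom.toLinearMap (Pi.single y 1) x = q x y :=
      fun x y => congrFun (congrFun (coeff_ofCoeff hstar hrow hsum) x) y
    funext x
    have ts : ∀ (a : G.C) (f : X → G.C), MinTensor.tmul a (∑ y, f y) =
        ∑ y, MinTensor.tmul a (f y) := fun a f => map_sum (MinTensor.tmulBilin _ _ a) f Finset.univ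
    have tc : ∀ (a b : G.C) (c : ℂ), MinTensor.tmul a (c • b) = c • MinTensor.tmul a b :=
      fun a b c => map_smul (MinTensor.tmulBilin _ _ a) c b
    show ∑ z, MinTensor.tmul _ (∑ y, f y • q z y) = G.Δ (∑ y, f y • q x y)
    simp only [hc, ts, tc, map_sum, map_smul, hΔ, Finset.smul_sum]
    exact Finset.sum_comm
  podles := by
    have : Submodule.span ℂ {F : X → G.C | ∃ (f : X → ℂ) (c : G.C),
        F = (ofCoeff q hstar hrow hsum).toAlgHom.toLinearMap f * tmul 1 c} = ⊤ := by
      refine Submodule.eq_top_iff'.mpr fun F => ?_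
      -- Column orthogonality inverts the matrix: at z the double sum collapses to ∑_y q_zy F(z) =
      -- F(z). The span is therefore everything, not merely dense.
      have e : F = ∑ x, ∑ y, ofCoeff q hstar hrow hsum (Pi.single y 1) * tmul 1 (q x y * F x) := by
        funext z
        have hc : ∀ y, ofCoeff q hstar hrow hsum (Pi.single y 1) z = q z y :=
          fun y => congrFun (congrFun (coeff_ofCoeff hstar hrow hsum) z) y
        simp only [Finset.sum_apply, Pi.mul_apply, hc, tmul, Pi.one_apply, one_smul, ← mul_assoc,
          hcol]
        rw [Finset.sum_eq_single z]
        · simp only [if_true]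
          rw [← Finset.sum_mul, hsum, one_mul]
        · intro x _ hx
          simp [Ne.symm hx]
        · exact fun hz => absurd (Finset.mem_univ z) hz
      rw [e]
      exact Submodule.sum_mem _ fun x _ => Submodule.sum_mem _ fun y _ =>
        Submodule.subset_span ⟨_, _, rfl⟩
    rw [Podles, this]
    exact dense_univ

end FinSpace

namespace MinTensor

variable {A B : Type u} [CStarAlgebra A] [CStarAlgebra B]

theorem tmul_zero (a : A) : tmul a (0 : B) = 0 := map_zero (tmulBilin A B a)

theorem zero_tmul (b : B) : tmul (0 : A) b = 0 := map_zero ((tmulBilin A B).flip b)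

theorem tmul_sum {ι : Type*} (s : Finset ι) (a : A) (b : ι → B) :
    tmul a (∑ i ∈ s, b i) = ∑ i ∈ s, tmul a (b i) :=
  map_sum (tmulBilin A B a) b s

theorem sum_tmul {ι : Type*} (s : Finset ι) (a : ι → A) (b : B) :
    tmul (∑ i ∈ s, a i) b = ∑ i ∈ s, tmul (a i) b :=
  map_sum ((tmulBilin A B).flip b) a s

theorem sum_tmul_mul_sum_tmul {ι : Type*} [Fintype ι] (a c : ι → A) (b d : ι → B) :
    (∑ i, tmul (a i) (b i)) * (∑ i, tmul (c i) (d i)) =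
      ∑ i, ∑ j, tmul (a i * c j) (b i * d j) := by
  refine (Finset.sum_mul_sum _ _ _ _).trans ?_
  exact Finset.sum_congr rfl fun _ _ => Finset.sum_congr rfl fun _ _ => tmul_mul_tmul _ _ _ _

end MinTensor

/-! ### The magic unitary on the edges and the object attached to a solution. -/

namespace DirectedGraph

variable {V : Type v} {E : Type w} [Fintype V]
  {𝒢 : DirectedGraph V E}

/-- Without multiple edges, edges are pairs of vertices. Sums over edges thus become free double
sums over vertices, to which the row and column sums apply. -/
theorem IsSimple.sum_edges [Fintype E] (h𝒢 : 𝒢.IsSimple) {M : Type*} [AddCommMonoid M] {F : V → V → M}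
    (hF : ∀ v w, ¬ 𝒢.IsEdge v w → F v w = 0) : ∑ e, F (𝒢.s e) (𝒢.r e) = ∑ v, ∑ w, F v w := by
  rw [← Fintype.sum_prod_type']
  refine Finset.sum_of_injOn (fun e => (𝒢.s e, 𝒢.r e)) (fun e _ f _ h => ?_) (fun _ _ => ?_)
    (fun p _ hp => ?_) fun _ _ => rfl
  · exact h𝒢.no_multiple_edges e f (congrArg Prod.fst h) (congrArg Prod.snd h)
  · exact Finset.mem_coe.mpr (Finset.mem_univ _)
  · refine hF _ _ fun ⟨e, h1, h2⟩ => hp ⟨e, Finset.mem_coe.mpr (Finset.mem_univ e), ?_⟩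
    exact Prod.ext h1 h2

variable (𝒢) in
/-- The matrix `q_{s(e)s(f)} q_{r(e)r(f)}` indexed by the edges. -/
def edgeMatrix {B : Type u} [CStarAlgebra B] (q : V → V → B) (e f : E) : B :=
  q (𝒢.s e) (𝒢.s f) * q (𝒢.r e) (𝒢.r f)

namespace BichonRelations

variable [DecidableEq V] {B : Type u} [CStarAlgebra B] {q : V → V → B} (h : 𝒢.BichonRelations q)
include h

theorem star_edgeMatrix (e f : E) : star (𝒢.edgeMatrix q e f) = 𝒢.edgeMatrix q e f := by
  rw [edgeMatrix, star_mul, h.star_eq, h.star_eq, h.comm]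

/-- The relation `comm` brings the two range factors together, and then the two source factors. An
edge is determined by its source and range. -/
theorem edgeMatrix_row [DecidableEq E] (h𝒢 : 𝒢.IsSimple) (e f g : E) :
    𝒢.edgeMatrix q e f * 𝒢.edgeMatrix q e g = if f = g then 𝒢.edgeMatrix q e f else 0 := by
  rw [edgeMatrix, edgeMatrix, h.comm e g, mul_assoc, ← mul_assoc (q (𝒢.r e) (𝒢.r f)), h.row]
  split_ifs with h1 h2 h2
  · rw [← mul_assoc, h.comm, mul_assoc, h.row, if_pos (congrArg 𝒢.s h2)]
  · rw [← mul_assoc, h.comm, mul_assoc, h.row,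
      if_neg fun hs => h2 (h𝒢.no_multiple_edges f g hs h1), mul_zero]
  · exact absurd (congrArg 𝒢.r h2) h1
  · rw [zero_mul, mul_zero]

theorem edgeMatrix_col [DecidableEq E] (h𝒢 : 𝒢.IsSimple) (e g f : E) :
    𝒢.edgeMatrix q e f * 𝒢.edgeMatrix q g f = if e = g then 𝒢.edgeMatrix q e f else 0 := by
  rw [edgeMatrix, edgeMatrix, h.comm g f, mul_assoc, ← mul_assoc (q (𝒢.r e) (𝒢.r f)), h.col]
  split_ifs with h1 h2 h2
  · rw [← mul_assoc, h.comm, mul_assoc, h.col, if_pos (congrArg 𝒢.s h2)]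
  · rw [← mul_assoc, h.comm, mul_assoc, h.col,
      if_neg fun hs => h2 (h𝒢.no_multiple_edges e g hs h1), mul_zero]
  · exact absurd (congrArg 𝒢.r h2) h1
  · rw [zero_mul, mul_zero]

theorem sum_edgeMatrix [Fintype E] (h𝒢 : 𝒢.IsSimple) (e : E) : ∑ f, 𝒢.edgeMatrix q e f = 1 := by
  refine (h𝒢.sum_edges (F := fun v w => q (𝒢.s e) v * q (𝒢.r e) w)
    fun v w hvw => (h.edge_left e v w hvw).1).trans ?_
  simp only [← Finset.mul_sum, h.sum_row, mul_one]

theorem sum_edgeMatrix_range [Fintype E] (h𝒢 : 𝒢.IsSimple) (v : V) (f : E) :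
    ∑ e with 𝒢.r e = v, 𝒢.edgeMatrix q e f = q v (𝒢.r f) := by
  rw [Finset.sum_filter]
  refine (h𝒢.sum_edges (F := fun u w => if w = v then q u (𝒢.s f) * q w (𝒢.r f) else 0)
    fun u w huw => ?_).trans ?_
  · split_ifs
    · exact (h.edge_right f u w huw).1
    · rfl
  · simp only [Finset.sum_ite_eq', Finset.mem_univ, if_true]
    rw [← Finset.sum_mul, h.sum_col, one_mul]

theorem edgeMatrix_mul (e f : E) (w : V) :
    𝒢.edgeMatrix q e f * q (𝒢.r e) w = if 𝒢.r f = w then 𝒢.edgeMatrix q e f else 0 := by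
  rw [edgeMatrix, mul_assoc, h.row]
  split_ifs
  · rfl
  · rw [mul_zero]

theorem mul_edgeMatrix (e f : E) (v : V) :
    q (𝒢.s e) v * 𝒢.edgeMatrix q e f = if 𝒢.s f = v then 𝒢.edgeMatrix q e f else 0 := by
  rw [edgeMatrix, ← mul_assoc, h.row]
  split_ifs with h1 h2 h2
  · rw [h1]
  · exact absurd h1.symm h2
  · exact absurd h2.symm h1
  · rw [zero_mul]

end BichonRelations

variable [DecidableEq V] [Fintype E]

theorem BichonRelations.comul_edgeMatrix {G : CompactQuantumGroup.{u}} {q : V → V → G.C}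
    (h : 𝒢.BichonRelations q) (h𝒢 : 𝒢.IsSimple)
    (hΔ : ∀ v w, G.Δ (q v w) = ∑ u, MinTensor.tmul (q v u) (q u w)) (e f : E) :
    G.Δ (𝒢.edgeMatrix q e f) =
      ∑ g, MinTensor.tmul (𝒢.edgeMatrix q e g) (𝒢.edgeMatrix q g f) := by
  rw [edgeMatrix, map_mul, hΔ, hΔ, MinTensor.sum_tmul_mul_sum_tmul]
  refine (h𝒢.sum_edges fun v w hvw => ?_).symm
  rw [(h.edge_left e v w hvw).1, MinTensor.zero_tmul]

variable [DecidableEq E]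

open FinSpace

/-- The object of the category defined by a compact quantum group whose algebra is generated by a
fundamental representation satisfying Bichon's relations. -/
def BicObj.ofRelations (h𝒢 : 𝒢.IsSimple) (G : CompactQuantumGroup.{u}) (q : V → V → G.C)
    (h : 𝒢.BichonRelations q) (hΔ : ∀ v w, G.Δ (q v w) = ∑ u, MinTensor.tmul (q v u) (q u w))
    (hgen : Dense (StarAlgebra.adjoin ℂ {c : G.C | ∃ v w, c = q v w} : Set G.C)) :
    BicObj.{u} 𝒢 where
  G := G
  α := ofCoeff q h.star_eq (fun v w u => h.row u v w) h.sum_row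
  lam := (ofCoeff (𝒢.edgeMatrix q) h.star_edgeMatrix (h.edgeMatrix_row h𝒢)
    (h.sum_edgeMatrix h𝒢)).toAlgHom.toLinearMap
  isAction := isAction_ofCoeff _ _ _ (fun v w u => h.col w v u) hΔ
  isFaithful := by
    refine hgen.mono ?_
    refine SetLike.coe_subset_coe.mpr (StarAlgebra.adjoin_mono ?_)
    rintro _ ⟨v, w, rfl⟩
    refine ⟨ContinuousLinearMap.proj v, Pi.single w 1, ?_⟩
    rw [slice, Finset.sum_eq_single v]
    · have := congrFun (congrFun (coeff_ofCoeff h.star_eq (fun v w u => h.row u v w) h.sum_row) v) w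
      rw [ContinuousLinearMap.proj_apply, Pi.single_eq_same, one_smul]
      exact this.symm
    · intro x _ hx
      rw [ContinuousLinearMap.proj_apply, Pi.single_eq_of_ne (Ne.symm hx), zero_smul]
    · exact fun hv => absurd (Finset.mem_univ v) hv
  isEquivariant :=
    { map_rightAct := fun ξ f => by
        funext e
        show ∑ g, (ξ g * f (𝒢.r g)) • 𝒢.edgeMatrix q e g =
          (∑ g, ξ g • 𝒢.edgeMatrix q e g) * ∑ w, f w • q (𝒢.r e) w
        rw [Finset.sum_mul]
        refine Finset.sum_congr rfl fun g _ => ?_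
        simp only [Finset.mul_sum, smul_mul_smul_comm, h.edgeMatrix_mul, smul_ite, smul_zero,
          Finset.sum_ite_eq, Finset.mem_univ, if_true]
      innerProd_map := fun ξ η => by
        funext v
        have e1 : ∀ e, star (∑ f, ξ f • 𝒢.edgeMatrix q e f) * (∑ g, η g • 𝒢.edgeMatrix q e g) =
            ∑ f, (star (ξ f) * η f) • 𝒢.edgeMatrix q e f := fun e => by
          rw [star_sum, Finset.sum_mul]
          refine Finset.sum_congr rfl fun f _ => ?_
          simp only [star_smul, h.star_edgeMatrix, Finset.mul_sum, smul_mul_smul_comm,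
            h.edgeMatrix_row h𝒢, smul_ite, smul_zero, Finset.sum_ite_eq, Finset.mem_univ, if_true]
        have e2 : 𝒢.innerProd (fun e => ∑ f, ξ f • 𝒢.edgeMatrix q e f)
            (fun e => ∑ g, η g • 𝒢.edgeMatrix q e g) v =
            ∑ f, (star (ξ f) * η f) • q v (𝒢.r f) := by
          simp only [innerProd, e1]
          rw [Finset.sum_comm]
          refine Finset.sum_congr rfl fun f _ => ?_
          rw [← Finset.smul_sum, h.sum_edgeMatrix_range h𝒢]
        refine e2.trans ?_
        show _ = ∑ w, (∑ f with 𝒢.r f = w, star (ξ f) * η f) • q v w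
        rw [← Finset.sum_fiberwise Finset.univ 𝒢.r]
        refine Finset.sum_congr rfl fun w _ => ?_
        rw [Finset.sum_smul]
        exact Finset.sum_congr rfl fun f hf => by rw [(Finset.mem_filter.mp hf).2]
      coassoc := (isAction_ofCoeff _ _ _ (h.edgeMatrix_col h𝒢) (h.comul_edgeMatrix h𝒢 hΔ)).coassoc
      -- The right action of 1 ⊗ c is pointwise multiplication by c, so this is the Podleś condition
      -- of the algebra action.
      podles := (isAction_ofCoeff _ _ _ (h.edgeMatrix_col h𝒢) (h.comul_edgeMatrix h𝒢 hΔ)).podles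
      map_leftAct := fun f ξ => by
        funext e
        show ∑ g, (f (𝒢.s g) * ξ g) • 𝒢.edgeMatrix q e g =
          (∑ w, f w • q (𝒢.s e) w) * (∑ g, ξ g • 𝒢.edgeMatrix q e g)
        rw [Finset.mul_sum]
        refine Finset.sum_congr rfl fun g _ => ?_
        simp only [Finset.sum_mul, smul_mul_smul_comm, h.mul_edgeMatrix, smul_ite, smul_zero,
          Finset.sum_ite_eq, Finset.mem_univ, if_true] }
  isAction_lam := ⟨_, fun _ => rfl,
    isAction_ofCoeff h.star_edgeMatrix (h.edgeMatrix_row h𝒢) (h.sum_edgeMatrix h𝒢)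
      (h.edgeMatrix_col h𝒢) (h.comul_edgeMatrix h𝒢 hΔ)⟩

end DirectedGraph

/-! ### The universal C*-algebra of Bichon's relations -/

/-- Extension of a contractive homomorphism from an algebra with dense image in a C*-algebra. -/
theorem exists_starAlgHom_of_norm_le {F : Type*} [Ring F] [Algebra ℂ F] {A B : Type*}
    [CStarAlgebra A] [CStarAlgebra B] (e : F →ₐ[ℂ] A) (he : DenseRange e) (g : F →ₐ[ℂ] B)
    (hg : ∀ x, ‖g x‖ ≤ ‖e x‖) (hstar : ∀ x, ∃ y, e y = star (e x) ∧ g y = star (g x)) :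
    ∃ f : A →⋆ₐ[ℂ] B, ∀ x, f (e x) = g x := by
  let f : A →L[ℂ] B := g.toLinearMap.extendOfNorm e.toLinearMap
  have hf : ∀ x, f (e x) = g x := fun x =>
    LinearMap.extendOfNorm_eq (f := g.toLinearMap) (e := e.toLinearMap) he
      ⟨1, fun x => by rw [one_mul]; exact hg x⟩ x
  have hone : f 1 = 1 := by rw [← map_one e, hf, map_one]
  refine ⟨{ toFun := f, map_one' := hone, map_zero' := map_zero f, map_add' := map_add f,
            map_mul' := fun x y => ?_, commutes' := fun c => ?_, map_star' := fun x => ?_ }, hf⟩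
  · have hcl : IsClosed {p : A × A | f (p.1 * p.2) = f p.1 * f p.2} :=
      isClosed_eq (f.continuous.comp continuous_mul)
        ((f.continuous.comp continuous_fst).mul (f.continuous.comp continuous_snd))
    refine he.induction_on₂ (p := fun x y => f (x * y) = f x * f y) hcl (fun x y => ?_) x y
    rw [← map_mul, hf, hf, hf, map_mul]
  · rw [Algebra.algebraMap_eq_smul_one, Algebra.algebraMap_eq_smul_one, map_smul, hone]
  · refine he.induction_on x (isClosed_eq (f.continuous.comp continuous_star)
      (continuous_star.comp f.continuous)) fun x => ?_
    obtain ⟨y, hy, hy'⟩ := hstar x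
    rw [← hy, hf, hf, hy']

namespace DirectedGraph

variable {V : Type v} {E : Type w} [Fintype V] [DecidableEq V] {𝒢 : DirectedGraph V E}

theorem BichonRelations.map {A B : Type u} [CStarAlgebra A] [CStarAlgebra B] {q : V → V → A}
    (h : 𝒢.BichonRelations q) (f : A →⋆ₐ[ℂ] B) : 𝒢.BichonRelations fun v w => f (q v w) where
  star_eq v w := by rw [← map_star, h.star_eq]
  row u v w := by rw [← map_mul, h.row, apply_ite f, map_zero]
  col u v w := by rw [← map_mul, h.col, apply_ite f, map_zero]
  sum_row v := by rw [← map_sum, h.sum_row, map_one]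
  sum_col v := by rw [← map_sum, h.sum_col, map_one]
  edge_left e v w hvw := by
    rw [← map_mul, ← map_mul, (h.edge_left e v w hvw).1, (h.edge_left e v w hvw).2, map_zero]
    exact ⟨rfl, rfl⟩
  edge_right e v w hvw := by
    rw [← map_mul, ← map_mul, (h.edge_right e v w hvw).1, (h.edge_right e v w hvw).2, map_zero]
    exact ⟨rfl, rfl⟩
  comm e f := by rw [← map_mul, ← map_mul, h.comm]

theorem BichonRelations.of_jointly_injective {A : Type u} [CStarAlgebra A] {q : V → V → A}
    {ι : Type*} {B : ι → Type u} [∀ i, CStarAlgebra (B i)] (f : ∀ i, A →⋆ₐ[ℂ] B i)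
    (hf : ∀ x y, (∀ i, f i x = f i y) → x = y)
    (h : ∀ i, 𝒢.BichonRelations fun v w => f i (q v w)) : 𝒢.BichonRelations q where
  star_eq v w := hf _ _ fun i => by rw [map_star, (h i).star_eq]
  row u v w := hf _ _ fun i => by rw [map_mul, (h i).row, apply_ite (f i), map_zero]
  col u v w := hf _ _ fun i => by rw [map_mul, (h i).col, apply_ite (f i), map_zero]
  sum_row v := hf _ _ fun i => by rw [map_sum, (h i).sum_row, map_one]
  sum_col v := hf _ _ fun i => by rw [map_sum, (h i).sum_col, map_one]
  edge_left e v w hvw :=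
    ⟨hf _ _ fun i => by rw [map_mul, ((h i).edge_left e v w hvw).1, map_zero],
      hf _ _ fun i => by rw [map_mul, ((h i).edge_left e v w hvw).2, map_zero]⟩
  edge_right e v w hvw :=
    ⟨hf _ _ fun i => by rw [map_mul, ((h i).edge_right e v w hvw).1, map_zero],
      hf _ _ fun i => by rw [map_mul, ((h i).edge_right e v w hvw).2, map_zero]⟩
  comm e f' := hf _ _ fun i => by rw [map_mul, map_mul, (h i).comm]

theorem BichonRelations.norm_le_one {A : Type u} [CStarAlgebra A] {q : V → V → A}
    (h : 𝒢.BichonRelations q) (v w : V) : ‖q v w‖ ≤ 1 := by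
  have h1 : ‖q v w‖ * ‖q v w‖ = ‖q v w‖ := by
    rw [← CStarRing.norm_star_mul_self, h.star_eq, h.row, if_pos rfl]
  nlinarith [norm_nonneg (q v w)]

/-- The identity matrix satisfies Bichon's relations. -/
theorem bichonRelations_one (B : Type u) [CStarAlgebra B] :
    𝒢.BichonRelations fun v w => if v = w then (1 : B) else 0 where
  star_eq v w := by split_ifs <;> simp
  row u v w := by
    by_cases h1 : v = w <;> by_cases h2 : v = u <;> simp_all
    rintro rfl; contradiction
  col u v w := by
    by_cases h1 : v = w <;> by_cases h2 : u = w <;> simp_all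
    rintro rfl; contradiction
  sum_row v := by simp
  sum_col v := by simp
  edge_left e v w hvw := by
    have : ¬ (𝒢.s e = v ∧ 𝒢.r e = w) := fun h => hvw ⟨e, h⟩
    by_cases h1 : 𝒢.s e = v <;> by_cases h2 : 𝒢.r e = w <;> simp_all
  edge_right e v w hvw := by
    have : ¬ (𝒢.s e = v ∧ 𝒢.r e = w) := fun h => hvw ⟨e, h⟩
    by_cases h1 : v = 𝒢.s e <;> by_cases h2 : w = 𝒢.r e <;> simp_all
  comm e f := by split_ifs <;> simp

/-- The free algebra on the matrix entries, indexed by a copy of `V × V` in the lowest universe. -/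
abbrev FreeMatrix (V : Type v) [Fintype V] : Type :=
  FreeAlgebra ℂ (Fin (Fintype.card V) × Fin (Fintype.card V))

/-- Evaluation of noncommutative polynomials at a matrix. -/
def evalMatrix {B : Type u} [CStarAlgebra B] (b : V → V → B) : FreeMatrix V →ₐ[ℂ] B :=
  FreeAlgebra.lift ℂ fun p => b ((Fintype.equivFin V).symm p.1) ((Fintype.equivFin V).symm p.2)

/-- The generator of the free algebra with indices `v`, `w`. -/
def freeEntry (v w : V) : FreeMatrix V :=
  FreeAlgebra.ι ℂ (Fintype.equivFin V v, Fintype.equivFin V w)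

omit [DecidableEq V] in
theorem evalMatrix_freeEntry {B : Type u} [CStarAlgebra B] (b : V → V → B) (v w : V) :
    evalMatrix b (freeEntry v w) = b v w := by
  rw [evalMatrix, freeEntry, FreeAlgebra.lift_ι_apply, Equiv.symm_apply_apply,
    Equiv.symm_apply_apply]

omit [DecidableEq V] in
theorem map_evalMatrix {A B : Type u} [CStarAlgebra A] [CStarAlgebra B] (f : A →⋆ₐ[ℂ] B)
    (b : V → V → A) (x : FreeMatrix V) :
    f (evalMatrix b x) = evalMatrix (fun v w => f (b v w)) x := by
  refine DFunLike.congr_fun (f := (f.toAlgHom.comp (evalMatrix b))) (FreeAlgebra.hom_ext ?_) x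
  funext p
  simp [evalMatrix]

omit [DecidableEq V] in
theorem evalMatrix_induction {p : FreeMatrix V → Prop} (halg : ∀ c, p (algebraMap ℂ _ c))
    (hgen : ∀ v w, p (freeEntry v w)) (hmul : ∀ x y, p x → p y → p (x * y))
    (hadd : ∀ x y, p x → p y → p (x + y)) (x : FreeMatrix V) : p x := by
  refine FreeAlgebra.induction ℂ _ halg (fun i => ?_) hmul hadd x
  have := hgen ((Fintype.equivFin V).symm i.1) ((Fintype.equivFin V).symm i.2)
  rwa [freeEntry, Equiv.apply_symm_apply, Equiv.apply_symm_apply] at this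

-- Reverse the monomials and conjugate the coefficients. The resulting polynomial serves all
-- self-adjoint matrices at once, so that a map between two models respects adjoints.
omit [DecidableEq V] in
theorem exists_star_evalMatrix (x : FreeMatrix V) : ∃ y : FreeMatrix V,
    ∀ (B : Type u) [CStarAlgebra B] (b : V → V → B), (∀ v w, star (b v w) = b v w) →
      evalMatrix b y = star (evalMatrix b x) := by
  induction x using evalMatrix_induction with
  | halg c =>
    refine ⟨algebraMap ℂ _ (star c), fun B _ b hb => ?_⟩
    rw [AlgHom.commutes, AlgHom.commutes, algebraMap_star_comm]
  | hgen v w => exact ⟨freeEntry v w, fun B _ b hb => by rw [evalMatrix_freeEntry, hb]⟩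
  | hmul x y hx hy =>
    obtain ⟨x', hx⟩ := hx
    obtain ⟨y', hy⟩ := hy
    exact ⟨y' * x', fun B _ b hb => by rw [map_mul, map_mul, star_mul, hx B b hb, hy B b hb]⟩
  | hadd x y hx hy =>
    obtain ⟨x', hx⟩ := hx
    obtain ⟨y', hy⟩ := hy
    exact ⟨x' + y', fun B _ b hb => by rw [map_add, map_add, star_add, hx B b hb, hy B b hb]⟩

variable (𝒢) in
/-- A matrix satisfying Bichon's relations over a nonzero unital C*-algebra. -/
structure BichonModel : Type (max (u + 1) v w) where
  B : Type u
  [cstarAlgebra : CStarAlgebra B]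
  [nontrivial : Nontrivial B]
  b : V → V → B
  rel : 𝒢.BichonRelations b

namespace BichonModel

attribute [instance] cstarAlgebra nontrivial

/-- The counit as a model, over a copy of ℂ in the right universe. It makes the universal algebra
nonzero. -/
instance : Nonempty (BichonModel.{u} 𝒢) :=
  ⟨{ B := ContinuousMap PUnit.{u + 1} ℂ, b := _, rel := bichonRelations_one _ }⟩

variable (𝒢) in
/-- The functions `x ↦ ‖x(b)‖` on noncommutative polynomials defined by the models `b`. -/
def Index : Type u :=
  ULift.{u} {p : FreeMatrix V → ℝ // ∃ M : BichonModel.{u} 𝒢, ∀ x, p x = ‖evalMatrix M.b x‖}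

/-- A model with given norm function. -/
def Index.model (i : Index.{u} 𝒢) : BichonModel.{u} 𝒢 := i.down.2.choose

theorem Index.norm_model (i : Index.{u} 𝒢) (x : FreeMatrix V) :
    ‖evalMatrix i.model.b x‖ = i.down.1 x := (i.down.2.choose_spec x).symm

variable (𝒢) in
/-- The C*-algebra of bounded families indexed by the models. -/
def Ambient : Type u := lp (fun i : Index.{u} 𝒢 => i.model.B) ∞

instance instAmbient : CStarAlgebra (Ambient.{u} 𝒢) :=
  { (inferInstance : NonUnitalCStarAlgebra (lp (fun i : Index.{u} 𝒢 => i.model.B) ∞)),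
    (inferInstance : NormedAlgebra ℂ (lp (fun i : Index.{u} 𝒢 => i.model.B) ∞)),
    (inferInstance : NormedRing (lp (fun i : Index.{u} 𝒢 => i.model.B) ∞)) with }

theorem Ambient.ext {x y : Ambient.{u} 𝒢} (h : ∀ i, x.1 i = y.1 i) : x = y :=
  Subtype.ext (funext h)

variable (𝒢) in
/-- The coordinate maps. -/
def Ambient.proj (i : Index.{u} 𝒢) : Ambient.{u} 𝒢 →⋆ₐ[ℂ] i.model.B where
  toFun x := x.1 i
  map_one' := rfl
  map_mul' _ _ := rfl
  map_zero' := rfl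
  map_add' _ _ := rfl
  commutes' _ := rfl
  map_star' _ := rfl

variable (𝒢) in
/-- The family of all models. -/
def Ambient.entry (v w : V) : Ambient.{u} 𝒢 :=
  ⟨fun i => i.model.b v w, memℓp_infty ⟨1, by
    rintro _ ⟨i, rfl⟩
    exact i.model.rel.norm_le_one v w⟩⟩

theorem Ambient.entry_rel : 𝒢.BichonRelations (Ambient.entry.{u} 𝒢) :=
  BichonRelations.of_jointly_injective (Ambient.proj 𝒢) (fun _ _ h => Ambient.ext h)
    fun i => i.model.rel

/-- The norm function of M is one of the indices. The model chosen for that index may differ from M,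
but it gives every polynomial the same norm. -/
theorem norm_evalMatrix_le (M : BichonModel.{u} 𝒢) (x : FreeMatrix V) :
    ‖evalMatrix M.b x‖ ≤ ‖evalMatrix (Ambient.entry.{u} 𝒢) x‖ := by
  let i : Index.{u} 𝒢 := ⟨fun x => ‖evalMatrix M.b x‖, M, fun _ => rfl⟩
  have h := lp.norm_apply_le_norm (E := fun i : Index.{u} 𝒢 => i.model.B) ENNReal.top_ne_zero
    (evalMatrix (Ambient.entry.{u} 𝒢) x) i
  refine (i.norm_model x).symm.le.trans (le_trans (le_of_eq ?_) h)
  exact congrArg norm (map_evalMatrix (Ambient.proj 𝒢 i) (Ambient.entry 𝒢) x).symm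

variable (𝒢) in
/-- The polynomials in the universal family. -/
def polynomials : StarSubalgebra ℂ (Ambient.{u} 𝒢) where
  toSubalgebra := (evalMatrix (Ambient.entry.{u} 𝒢)).range
  star_mem' := by
    rintro _ ⟨x, rfl⟩
    obtain ⟨y, hy⟩ := exists_star_evalMatrix.{u} x
    exact ⟨y, hy _ _ Ambient.entry_rel.star_eq⟩

end BichonModel

open BichonModel

variable (𝒢) in
/-- The universal unital C*-algebra generated by a matrix satisfying Bichon's relations. -/
def BichonAlgebra : Type u := (polynomials.{u} 𝒢).topologicalClosure

namespace BichonAlgebra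

instance : IsClosed ((polynomials.{u} 𝒢).topologicalClosure : Set (Ambient.{u} 𝒢)) :=
  StarSubalgebra.isClosed_topologicalClosure _

instance : CStarAlgebra (BichonAlgebra.{u} 𝒢) :=
  StarSubalgebra.cstarAlgebra (polynomials.{u} 𝒢).topologicalClosure

variable (𝒢) in
/-- The inclusion into the algebra of bounded families. -/
def incl : BichonAlgebra.{u} 𝒢 →⋆ₐ[ℂ] Ambient.{u} 𝒢 :=
  (polynomials.{u} 𝒢).topologicalClosure.subtype

theorem incl_injective : Function.Injective (incl.{u} 𝒢) := Subtype.val_injective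

variable (𝒢) in
/-- The generators. -/
def q (v w : V) : BichonAlgebra.{u} 𝒢 :=
  ⟨Ambient.entry 𝒢 v w, StarSubalgebra.le_topologicalClosure _
    ⟨freeEntry v w, evalMatrix_freeEntry _ v w⟩⟩

theorem q_rel : 𝒢.BichonRelations (q.{u} 𝒢) :=
  BichonRelations.of_jointly_injective (fun _ : Unit => incl 𝒢)
    (fun _ _ h => incl_injective (h ())) fun _ => Ambient.entry_rel

theorem incl_evalMatrix (x : FreeMatrix V) :
    incl.{u} 𝒢 (evalMatrix (q 𝒢) x) = evalMatrix (Ambient.entry 𝒢) x :=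
  map_evalMatrix (incl 𝒢) (q 𝒢) x

theorem denseRange_evalMatrix : DenseRange (evalMatrix (q.{u} 𝒢)) := by
  intro x
  have hx : (incl.{u} 𝒢 x : Ambient.{u} 𝒢) ∈
      closure (Set.range (evalMatrix (Ambient.entry.{u} 𝒢))) := x.2
  refine (closure_subtype (s := Set.range (evalMatrix (q.{u} 𝒢)))).mpr (closure_mono ?_ hx)
  rintro _ ⟨y, rfl⟩
  exact ⟨_, ⟨y, rfl⟩, incl_evalMatrix y⟩

/-- A closed subalgebra containing the generators contains everything. -/
theorem mem_of_isClosed {S : Subalgebra ℂ (BichonAlgebra.{u} 𝒢)}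
    (hS : IsClosed (S : Set (BichonAlgebra.{u} 𝒢))) (hq : ∀ v w, q 𝒢 v w ∈ S)
    (x : BichonAlgebra.{u} 𝒢) : x ∈ S := by
  refine denseRange_evalMatrix.induction_on (p := fun x => x ∈ S) x hS fun x => ?_
  induction x using evalMatrix_induction with
  | halg c => rw [AlgHom.commutes]; exact S.algebraMap_mem c
  | hgen v w => rw [evalMatrix_freeEntry]; exact hq v w
  | hmul x y hx hy => rw [map_mul]; exact S.mul_mem hx hy
  | hadd x y hx hy => rw [map_add]; exact S.add_mem hx hy

theorem exists_hom {B : Type u} [CStarAlgebra B] {b : V → V → B} (h : 𝒢.BichonRelations b) :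
    ∃ f : BichonAlgebra.{u} 𝒢 →⋆ₐ[ℂ] B, ∀ v w, f (q 𝒢 v w) = b v w := by
  -- Models are nonzero algebras by definition, so the zero algebra is treated separately.
  cases subsingleton_or_nontrivial B with
  | inl _ =>
    exact ⟨{ toFun := fun _ => 0
             map_one' := Subsingleton.elim _ _
             map_mul' := fun _ _ => Subsingleton.elim _ _
             map_zero' := rfl
             map_add' := fun _ _ => Subsingleton.elim _ _
             commutes' := fun _ => Subsingleton.elim _ _
             map_star' := fun _ => Subsingleton.elim _ _ }, fun _ _ => Subsingleton.elim _ _⟩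
  | inr _ =>
    have hle : ∀ x, ‖evalMatrix b x‖ ≤ ‖evalMatrix (q.{u} 𝒢) x‖ := fun x => by
      refine (norm_evalMatrix_le ⟨B, b, h⟩ x).trans (le_of_eq ?_)
      rw [← incl_evalMatrix]
      rfl
    have hstar : ∀ x, ∃ y, evalMatrix (q.{u} 𝒢) y = star (evalMatrix (q.{u} 𝒢) x) ∧
        evalMatrix b y = star (evalMatrix b x) := fun x => by
      obtain ⟨y, hy⟩ := exists_star_evalMatrix.{u} x
      exact ⟨y, hy _ _ q_rel.star_eq, hy _ _ h.star_eq⟩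
    obtain ⟨f, hf⟩ := exists_starAlgHom_of_norm_le _ denseRange_evalMatrix _ hle hstar
    refine ⟨f, fun v w => ?_⟩
    rw [← evalMatrix_freeEntry (q 𝒢) v w, hf, evalMatrix_freeEntry]

theorem hom_ext {B : Type u} [CStarAlgebra B] {f g : BichonAlgebra.{u} 𝒢 →⋆ₐ[ℂ] B}
    (h : ∀ v w, f (q 𝒢 v w) = g (q 𝒢 v w)) : f = g := by
  refine DFunLike.ext _ _ fun x => ?_
  exact mem_of_isClosed (S := AlgHom.equalizer f.toAlgHom g.toAlgHom)
    (isClosed_eq f.toCLM.continuous g.toCLM.continuous) h x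

instance : Nontrivial (BichonAlgebra.{u} 𝒢) := by
  obtain ⟨M⟩ := (inferInstance : Nonempty (BichonModel.{u} 𝒢))
  obtain ⟨f, -⟩ := exists_hom M.rel
  exact f.toAlgHom.toRingHom.domain_nontrivial

end BichonAlgebra

end DirectedGraph

/-! ### Bichon's quantum automorphism group -/

namespace MinTensor

variable {A B C : Type u} [CStarAlgebra A] [CStarAlgebra B] [CStarAlgebra C]

variable (A B) in
/-- The embedding `a ↦ a ⊗ 1`. -/
def inclLeft : A →⋆ₐ[ℂ] MinTensor A B where
  toFun a := tmul a 1
  map_one' := tmul_one_one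
  map_mul' a b := by rw [tmul_mul_tmul, one_mul]
  map_zero' := zero_tmul 1
  map_add' a b := by simp only [← tmulBilin_apply, map_add, LinearMap.add_apply]
  commutes' c := by
    rw [Algebra.algebraMap_eq_smul_one, Algebra.algebraMap_eq_smul_one, ← tmul_one_one]
    simp only [← tmulBilin_apply, map_smul, LinearMap.smul_apply]
  map_star' a := by rw [star_tmul, star_one]

variable (A B) in
/-- The embedding `b ↦ 1 ⊗ b`. -/
def inclRight : B →⋆ₐ[ℂ] MinTensor A B where
  toFun b := tmul 1 b
  map_one' := tmul_one_one
  map_mul' a b := by rw [tmul_mul_tmul, one_mul]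
  map_zero' := tmul_zero 1
  map_add' a b := by simp only [← tmulBilin_apply, map_add]
  commutes' c := by
    rw [Algebra.algebraMap_eq_smul_one, Algebra.algebraMap_eq_smul_one, ← tmul_one_one]
    simp only [← tmulBilin_apply, map_smul]
  map_star' a := by rw [star_tmul, star_one]

theorem inclLeft_apply (a : A) : inclLeft A B a = tmul a 1 := rfl

theorem inclRight_apply (b : B) : inclRight A B b = tmul 1 b := rfl

theorem eq_top_of_tmul_mem {W : Submodule ℂ (MinTensor A B)} (hW : IsClosed (W : Set (MinTensor A B)))
    (h : ∀ a b, tmul a b ∈ W) (x : MinTensor A B) : x ∈ W := by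
  refine denseRange_of.induction_on (p := fun x => x ∈ W) x hW fun y => ?_
  induction y using TensorProduct.induction_on with
  | zero => rw [map_zero]; exact W.zero_mem
  | add y z hy hz => rw [map_add]; exact W.add_mem hy hz
  | tmul a b => exact h a b

/-- The pairs of corresponding elementary tensors in the two threefold tensor products. -/
def assocSubmonoid (A B C : Type u) [CStarAlgebra A] [CStarAlgebra B] [CStarAlgebra C] :
    Submonoid (MinTensor (MinTensor A B) C × MinTensor A (MinTensor B C)) where
  carrier := {p | ∃ (a : A) (b : B) (c : C), p = (tmul (tmul a b) c, tmul a (tmul b c))}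
  one_mem' := ⟨1, 1, 1, by simp only [tmul_one_one]; rfl⟩
  mul_mem' := by
    rintro _ _ ⟨a, b, c, rfl⟩ ⟨a', b', c', rfl⟩
    exact ⟨a * a', b * b', c * c', by simp only [Prod.mk_mul_mk, tmul_mul_tmul]⟩

/-- The closed subalgebra of pairs of corresponding elements. -/
def assocSubalgebra (A B C : Type u) [CStarAlgebra A] [CStarAlgebra B] [CStarAlgebra C] :
    Subalgebra ℂ (MinTensor (MinTensor A B) C × MinTensor A (MinTensor B C)) :=
  (Algebra.adjoin ℂ (assocSubmonoid A B C :
    Set (MinTensor (MinTensor A B) C × MinTensor A (MinTensor B C)))).topologicalClosure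

/-- Elementary pairs are closed under products, so their span is already a subalgebra.
Coassociativity thereby becomes membership in a closed subalgebra, which can be checked on
generators. -/
theorem assocEq_iff_mem {y : MinTensor (MinTensor A B) C} {x : MinTensor A (MinTensor B C)} :
    AssocEq y x ↔ (y, x) ∈ assocSubalgebra A B C := by
  let P := MinTensor (MinTensor A B) C × MinTensor A (MinTensor B C)
  have h := Algebra.adjoin_eq_span (R := ℂ) (s := (assocSubmonoid A B C : Set P))
  rw [Submonoid.closure_eq] at h
  have h' : (Algebra.adjoin ℂ (assocSubmonoid A B C : Set P) : Set P) =
      (Submodule.span ℂ (assocSubmonoid A B C : Set P) : Set P) := congrArg SetLike.coe h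
  rw [← SetLike.mem_coe, assocSubalgebra, Subalgebra.topologicalClosure_coe, h']
  rfl

end MinTensor

/-! ### The comultiplication and the density conditions. -/

namespace DirectedGraph

variable {V : Type v} {E : Type w} [Fintype V] {𝒢 : DirectedGraph V E}

/-- The matrix `∑ᵤ q_{vu} ⊗ q_{uw}`. -/
def comulMatrix {A : Type u} [CStarAlgebra A] (q : V → V → A) (v w : V) : MinTensor A A :=
  ∑ u, MinTensor.tmul (q v u) (q u w)

open MinTensor

variable [DecidableEq V]

/-- For the graph relations, split the intermediate pairs (u, u'): on an edge one tensor leg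
reproduces the desired relation, and off the edges a leg vanishes. -/
theorem BichonRelations.comulMatrix {A : Type u} [CStarAlgebra A]
    {q : V → V → A} (h : 𝒢.BichonRelations q) : 𝒢.BichonRelations (comulMatrix q) where
  star_eq v w := by
    rw [DirectedGraph.comulMatrix, star_sum]
    exact Finset.sum_congr rfl fun u _ => by rw [MinTensor.star_tmul, h.star_eq, h.star_eq]
  row u v w := by
    rw [DirectedGraph.comulMatrix, DirectedGraph.comulMatrix, sum_tmul_mul_sum_tmul]
    have e : ∀ x, ∑ x', MinTensor.tmul (q v x * q v x') (q x w * q x' u) =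
        if w = u then MinTensor.tmul (q v x) (q x w) else 0 := fun x => by
      rw [Finset.sum_eq_single x]
      · rw [h.row, if_pos rfl, h.row]
        split_ifs
        · rfl
        · exact MinTensor.tmul_zero _
      · intro x' _ hx
        rw [h.row, if_neg (Ne.symm hx), MinTensor.zero_tmul]
      · exact fun hx => absurd (Finset.mem_univ x) hx
    simp only [e]
    split_ifs
    · rfl
    · exact Finset.sum_const_zero
  col u v w := by
    rw [DirectedGraph.comulMatrix, DirectedGraph.comulMatrix, sum_tmul_mul_sum_tmul]
    have e : ∀ x, ∑ x', MinTensor.tmul (q v x * q u x') (q x w * q x' w) =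
        if v = u then MinTensor.tmul (q v x) (q x w) else 0 := fun x => by
      rw [Finset.sum_eq_single x]
      · rw [h.col, h.col, if_pos rfl]
        split_ifs
        · rfl
        · exact MinTensor.zero_tmul _
      · intro x' _ hx
        rw [h.col x', if_neg (Ne.symm hx), MinTensor.tmul_zero]
      · exact fun hx => absurd (Finset.mem_univ x) hx
    simp only [e]
    split_ifs
    · rfl
    · exact Finset.sum_const_zero
  sum_row v := by
    simp only [DirectedGraph.comulMatrix]
    rw [Finset.sum_comm]
    simp only [← tmul_sum, h.sum_row, ← sum_tmul]
    exact tmul_one_one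
  sum_col v := by
    simp only [DirectedGraph.comulMatrix]
    rw [Finset.sum_comm]
    simp only [← sum_tmul, h.sum_col, ← tmul_sum]
    exact tmul_one_one
  edge_left e v w hvw := by
    constructor
    all_goals
      rw [DirectedGraph.comulMatrix, DirectedGraph.comulMatrix, sum_tmul_mul_sum_tmul]
      refine Finset.sum_eq_zero fun u _ => Finset.sum_eq_zero fun u' _ => ?_
    · by_cases hu : 𝒢.IsEdge u u'
      · obtain ⟨f, rfl, rfl⟩ := hu
        rw [(h.edge_left f v w hvw).1, MinTensor.tmul_zero]
      · rw [(h.edge_left e u u' hu).1, MinTensor.zero_tmul]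
    · by_cases hu : 𝒢.IsEdge u' u
      · obtain ⟨f, rfl, rfl⟩ := hu
        rw [(h.edge_left f v w hvw).2, MinTensor.tmul_zero]
      · rw [(h.edge_left e u' u hu).2, MinTensor.zero_tmul]
  edge_right e v w hvw := by
    constructor
    all_goals
      rw [DirectedGraph.comulMatrix, DirectedGraph.comulMatrix, sum_tmul_mul_sum_tmul]
      refine Finset.sum_eq_zero fun u _ => Finset.sum_eq_zero fun u' _ => ?_
    · by_cases hu : 𝒢.IsEdge u u'
      · obtain ⟨f, rfl, rfl⟩ := hu
        rw [(h.edge_right f v w hvw).1, MinTensor.zero_tmul]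
      · rw [(h.edge_right e u u' hu).1, MinTensor.tmul_zero]
    · by_cases hu : 𝒢.IsEdge u' u
      · obtain ⟨f, rfl, rfl⟩ := hu
        rw [(h.edge_right f v w hvw).2, MinTensor.zero_tmul]
      · rw [(h.edge_right e u' u hu).2, MinTensor.tmul_zero]
  comm e f := by
    rw [DirectedGraph.comulMatrix, DirectedGraph.comulMatrix, sum_tmul_mul_sum_tmul,
      sum_tmul_mul_sum_tmul]
    refine Eq.trans ?_ Finset.sum_comm
    refine Finset.sum_congr rfl fun u _ => Finset.sum_congr rfl fun u' _ => ?_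
    by_cases hu : 𝒢.IsEdge u u'
    · obtain ⟨g, rfl, rfl⟩ := hu
      rw [h.comm, h.comm]
    · rw [(h.edge_left e u u' hu).1, (h.edge_left e u u' hu).2, MinTensor.zero_tmul,
        MinTensor.zero_tmul]

namespace BichonAlgebra

variable (𝒢) in
/-- The comultiplication `Δ(q_{vw}) = ∑ᵤ q_{vu} ⊗ q_{uw}`. -/
def comul :
    BichonAlgebra.{u} 𝒢 →⋆ₐ[ℂ] MinTensor (BichonAlgebra.{u} 𝒢) (BichonAlgebra.{u} 𝒢) :=
  (exists_hom (q_rel.comulMatrix)).choose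

theorem comul_q (v w : V) :
    comul 𝒢 (q.{u} 𝒢 v w) = ∑ u, MinTensor.tmul (q 𝒢 v u) (q 𝒢 u w) :=
  (exists_hom (q_rel.comulMatrix)).choose_spec v w

theorem comul_coassoc (a : BichonAlgebra.{u} 𝒢) :
    AssocEq (MinTensor.map (comul 𝒢) (StarAlgHom.id ℂ _) (comul 𝒢 a))
      (MinTensor.map (StarAlgHom.id ℂ _) (comul 𝒢) (comul 𝒢 a)) := by
  let f := (MinTensor.map (comul 𝒢) (StarAlgHom.id ℂ (BichonAlgebra.{u} 𝒢))).comp (comul 𝒢)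
  let g := (MinTensor.map (StarAlgHom.id ℂ (BichonAlgebra.{u} 𝒢)) (comul 𝒢)).comp (comul 𝒢)
  refine assocEq_iff_mem.mpr ?_
  refine mem_of_isClosed (S := (assocSubalgebra _ _ _).comap (f.toAlgHom.prod g.toAlgHom)) ?_
    (fun v w => ?_) a
  · exact (Subalgebra.isClosed_topologicalClosure _).preimage
      (f.toCLM.continuous.prodMk g.toCLM.continuous)
  · have hf : f (q 𝒢 v w) = ∑ u, ∑ t, tmul (tmul (q 𝒢 v t) (q 𝒢 t u)) (q 𝒢 u w) := by
      show MinTensor.map (comul 𝒢) (StarAlgHom.id ℂ _) (comul 𝒢 (q 𝒢 v w)) = _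
      rw [comul_q, map_sum]
      refine Finset.sum_congr rfl fun u _ => ?_
      rw [map_tmul, comul_q, sum_tmul]
      rfl
    have hg : g (q 𝒢 v w) = ∑ u, ∑ t, tmul (q 𝒢 v t) (tmul (q 𝒢 t u) (q 𝒢 u w)) := by
      show MinTensor.map (StarAlgHom.id ℂ _) (comul 𝒢) (comul 𝒢 (q 𝒢 v w)) = _
      rw [comul_q, map_sum, Finset.sum_comm]
      refine Finset.sum_congr rfl fun u _ => ?_
      rw [map_tmul, comul_q, tmul_sum]
      rfl
    show (f (q 𝒢 v w), g (q 𝒢 v w)) ∈ assocSubalgebra _ _ _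
    have e : (f (q 𝒢 v w), g (q 𝒢 v w)) = ∑ u, ∑ t,
        (tmul (tmul (q 𝒢 v t) (q 𝒢 t u)) (q 𝒢 u w), tmul (q 𝒢 v t) (tmul (q 𝒢 t u) (q 𝒢 u w))) := by
      simp only [hf, hg, Prod.ext_iff, Prod.fst_sum, Prod.snd_sum, and_self]
    rw [e]
    refine Subalgebra.sum_mem _ fun u _ => Subalgebra.sum_mem _ fun t _ => ?_
    exact Subalgebra.le_topologicalClosure _ (Algebra.subset_adjoin ⟨_, _, _, rfl⟩)

/-- The span of `Δ(C)(j(C))` is dense for the embedding `j` of one leg if its closure contains the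
images of the generators in the other leg. -/
theorem dense_span_mul
    (D j k : BichonAlgebra.{u} 𝒢 →⋆ₐ[ℂ] MinTensor (BichonAlgebra.{u} 𝒢) (BichonAlgebra.{u} 𝒢))
    (hjk : ∀ a b, j a * k b = k b * j a)
    (htmul : ∀ a b, ∃ c d, tmul a b = k c * j d)
    (hq : ∀ v w, k (q 𝒢 v w) ∈ Submodule.span ℂ {x | ∃ a b, x = D a * j b}) :
    Dense (Submodule.span ℂ {x | ∃ a b, x = D a * j b} :
      Set (MinTensor (BichonAlgebra.{u} 𝒢) (BichonAlgebra.{u} 𝒢))) := by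
  set W := (Submodule.span ℂ {x | ∃ a b, x = D a * j b}).topologicalClosure with hWdef
  have hW : IsClosed (W : Set (MinTensor (BichonAlgebra.{u} 𝒢) (BichonAlgebra.{u} 𝒢))) :=
    Submodule.isClosed_topologicalClosure _
  have stable : ∀ T : MinTensor (BichonAlgebra.{u} 𝒢) (BichonAlgebra.{u} 𝒢) →L[ℂ]
      MinTensor (BichonAlgebra.{u} 𝒢) (BichonAlgebra.{u} 𝒢),
      (∀ a b, T (D a * j b) ∈ W) → ∀ x ∈ W, T x ∈ W := fun T hT x hx => by
    have : W ≤ W.comap T.toLinearMap := by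
      refine Submodule.topologicalClosure_minimal _ (Submodule.span_le.mpr ?_)
        (hW.preimage T.continuous)
      rintro _ ⟨a, b, rfl⟩
      exact hT a b
    exact this hx
  have hmem : ∀ a b, D a * j b ∈ W := fun a b =>
    Submodule.le_topologicalClosure _ (Submodule.subset_span ⟨a, b, rfl⟩)
  have hright : ∀ b x, x ∈ W → x * j b ∈ W := fun b =>
    stable ((ContinuousLinearMap.mul ℂ _).flip (j b)) fun a c => by
      show D a * j c * j b ∈ W
      rw [mul_assoc, ← map_mul]
      exact hmem _ _
  have hleft : ∀ a x, x ∈ W → D a * x ∈ W := fun a =>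
    stable (ContinuousLinearMap.mul ℂ _ (D a)) fun c b => by
      show D a * (D c * j b) ∈ W
      rw [← mul_assoc, ← map_mul]
      exact hmem _ _
  -- Closed under products: approximate k(a) by sums of D(c) j(d), move k(b) past j(d), and use that
  -- W is stable under D on the left and j on the right.
  let S : Subalgebra ℂ (BichonAlgebra.{u} 𝒢) :=
    { carrier := {a | k a ∈ W}
      mul_mem' := fun {a b} ha hb => by
        show k (a * b) ∈ W
        rw [map_mul]
        refine stable ((ContinuousLinearMap.mul ℂ _).flip (k b)) (fun c d => ?_) _ ha
        show D c * j d * k b ∈ W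
        rw [mul_assoc, hjk]
        exact hleft _ _ (hright _ _ hb)
      add_mem' := fun {a b} ha hb => by
        show k (a + b) ∈ W
        rw [map_add]
        exact W.add_mem ha hb
      algebraMap_mem' := fun c => by
        show k (algebraMap ℂ _ c) ∈ W
        have h1 : (1 : MinTensor (BichonAlgebra.{u} 𝒢) (BichonAlgebra.{u} 𝒢)) ∈ W := by
          have := hmem 1 1
          rwa [map_one, map_one, mul_one] at this
        rw [AlgHomClass.commutes, Algebra.algebraMap_eq_smul_one]
        exact W.smul_mem c h1 }
  have hk : ∀ a, k a ∈ W := mem_of_isClosed (S := S) (hW.preimage k.toCLM.continuous)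
    fun v w => Submodule.le_topologicalClosure _ (hq v w)
  intro x
  refine eq_top_of_tmul_mem hW (fun a b => ?_) x
  obtain ⟨c, d, hcd⟩ := htmul a b
  rw [hcd]
  exact hright _ _ (hk c)

variable (𝒢) in
/-- Bichon's quantum automorphism group. -/
def quantumGroup : CompactQuantumGroup.{u} where
  C := BichonAlgebra.{u} 𝒢
  Δ := comul 𝒢
  coassoc := comul_coassoc
  dense_right := by
    refine dense_span_mul (comul 𝒢) (inclRight _ _) (inclLeft _ _) (fun a b => ?_)
      (fun a b => ⟨a, b, ?_⟩) fun v w => ?_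
    · rw [inclRight_apply, inclLeft_apply, tmul_mul_tmul, tmul_mul_tmul, one_mul, mul_one, one_mul,
        mul_one]
    · rw [inclRight_apply, inclLeft_apply, tmul_mul_tmul, one_mul, mul_one]
    · have e : inclLeft (BichonAlgebra.{u} 𝒢) (BichonAlgebra.{u} 𝒢) (q 𝒢 v w) =
          ∑ z, comul 𝒢 (q 𝒢 v z) * inclRight _ _ (q 𝒢 w z) := by
        have e1 : ∀ z, comul 𝒢 (q.{u} 𝒢 v z) * inclRight _ _ (q 𝒢 w z) =
            tmul (q 𝒢 v w) (q 𝒢 w z) := fun z => by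
          rw [comul_q, inclRight_apply]
          refine (Finset.sum_mul _ _ _).trans ?_
          rw [Finset.sum_eq_single w]
          · rw [tmul_mul_tmul, mul_one, q_rel.col, if_pos rfl]
          · intro u _ hu
            rw [tmul_mul_tmul, q_rel.col, if_neg hu, MinTensor.tmul_zero]
          · exact fun hw => absurd (Finset.mem_univ w) hw
        simp only [e1]
        rw [← tmul_sum, q_rel.sum_row]
        rfl
      rw [e]
      exact Submodule.sum_mem _ fun z _ => Submodule.subset_span ⟨_, _, rfl⟩
  dense_left := by
    refine dense_span_mul (comul 𝒢) (inclLeft _ _) (inclRight _ _) (fun a b => ?_)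
      (fun a b => ⟨b, a, ?_⟩) fun v w => ?_
    · rw [inclRight_apply, inclLeft_apply, tmul_mul_tmul, tmul_mul_tmul, one_mul, mul_one, one_mul,
        mul_one]
    · rw [inclRight_apply, inclLeft_apply, tmul_mul_tmul, one_mul, mul_one]
    · have e : inclRight (BichonAlgebra.{u} 𝒢) (BichonAlgebra.{u} 𝒢) (q 𝒢 v w) =
          ∑ z, comul 𝒢 (q 𝒢 z w) * inclLeft _ _ (q 𝒢 z v) := by
        have e1 : ∀ z, comul 𝒢 (q.{u} 𝒢 z w) * inclLeft _ _ (q 𝒢 z v) =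
            tmul (q 𝒢 z v) (q 𝒢 v w) := fun z => by
          rw [comul_q, inclLeft_apply]
          refine (Finset.sum_mul _ _ _).trans ?_
          rw [Finset.sum_eq_single v]
          · rw [tmul_mul_tmul, mul_one, q_rel.row, if_pos rfl]
          · intro u _ hu
            rw [tmul_mul_tmul, q_rel.row, if_neg hu, MinTensor.zero_tmul]
          · exact fun hv => absurd (Finset.mem_univ v) hv
        simp only [e1]
        rw [← sum_tmul, q_rel.sum_col]
        rfl
      rw [e]
      exact Submodule.sum_mem _ fun z _ => Submodule.subset_span ⟨_, _, rfl⟩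

theorem isBichonQuantumAut :
    𝒢.IsBichonQuantumAut (quantumGroup.{u} 𝒢) := by
  refine ⟨q 𝒢, q_rel, fun B _ b hb => ?_, comul_q⟩
  obtain ⟨f, hf⟩ := exists_hom hb
  exact ⟨f, hf, fun g hg => hom_ext fun v w => (hg v w).trans (hf v w).symm⟩

theorem dense_adjoin : Dense (StarAlgebra.adjoin ℂ
    {c : (quantumGroup.{u} 𝒢).C | ∃ v w, c = q 𝒢 v w} : Set (quantumGroup.{u} 𝒢).C) := by
  refine (denseRange_evalMatrix (𝒢 := 𝒢)).mono ?_
  rintro _ ⟨x, rfl⟩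
  let S := StarAlgebra.adjoin ℂ {c : BichonAlgebra.{u} 𝒢 | ∃ v w, c = q 𝒢 v w}
  show evalMatrix (q.{u} 𝒢) x ∈ S
  induction x using evalMatrix_induction with
  | halg c => rw [AlgHom.commutes]; exact S.algebraMap_mem c
  | hgen v w =>
    rw [evalMatrix_freeEntry]
    exact StarAlgebra.subset_adjoin ℂ _ ⟨v, w, rfl⟩
  | hmul x y hx hy => rw [map_mul]; exact S.mul_mem hx hy
  | hadd x y hx hy => rw [map_add]; exact S.add_mem hx hy

end BichonAlgebra

/-- The universal property gives mutually inverse maps of the algebras. They respect Δ because both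
sides of that identity agree on generators. -/
theorem IsBichonQuantumAut.nonempty_iso {A A' : CompactQuantumGroup.{u}}
    (h : 𝒢.IsBichonQuantumAut A) (h' : 𝒢.IsBichonQuantumAut A') : Nonempty (A ≅ A') := by
  have mk : ∀ {A A' : CompactQuantumGroup.{u}} {q : V → V → A.C} {q' : V → V → A'.C},
      𝒢.BichonRelations q' → (∀ (B : Type u) [CStarAlgebra B] (b : V → V → B),
        𝒢.BichonRelations b → ∃! f : A.C →⋆ₐ[ℂ] B, ∀ v w, f (q v w) = b v w) →
      (∀ v w, A.Δ (q v w) = ∑ u, MinTensor.tmul (q v u) (q u w)) →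
      (∀ v w, A'.Δ (q' v w) = ∑ u, MinTensor.tmul (q' v u) (q' u w)) →
      ∃ F : A' ⟶ A, ∀ v w, CompactQuantumGroup.Hom.hom F (q v w) = q' v w := by
    intro A A' q q' hq' hu hΔ hΔ'
    obtain ⟨f, hf, -⟩ := hu A'.C q' hq'
    have e : (MinTensor.map f f).comp A.Δ = A'.Δ.comp f := by
      refine (hu _ _ (hq'.map A'.Δ)).unique (fun v w => ?_) fun v w => ?_
      · rw [StarAlgHom.comp_apply, hΔ, hΔ', map_sum]
        exact Finset.sum_congr rfl fun u _ => by rw [map_tmul, hf, hf]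
      · rw [StarAlgHom.comp_apply, hf]
    exact ⟨⟨f, fun a => DFunLike.congr_fun e a⟩, hf⟩
  obtain ⟨q, hq, hu, hΔ⟩ := h
  obtain ⟨q', hq', hu', hΔ'⟩ := h'
  obtain ⟨F, hF⟩ := mk hq' hu hΔ hΔ'
  obtain ⟨F', hF'⟩ := mk hq hu' hΔ' hΔ
  refine ⟨⟨F', F, ?_, ?_⟩⟩
  · refine CompactQuantumGroup.Hom.ext ?_
    refine (hu A.C q hq).unique (fun v w => ?_) fun v w => rfl
    show F'.hom (F.hom (q v w)) = q v w
    rw [hF, hF']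
  · refine CompactQuantumGroup.Hom.ext ?_
    refine (hu' A'.C q' hq').unique (fun v w => ?_) fun v w => rfl
    show F.hom (F'.hom (q' v w)) = q' v w
    rw [hF', hF]

variable [Fintype E] [DecidableEq E]

open FinSpace

/-! ### The terminal object. -/

namespace BicObj

variable (𝒢) in
/-- The universal object of the category. -/
def universal (h𝒢 : 𝒢.IsSimple) : BicObj.{u} 𝒢 :=
  ofRelations h𝒢 (BichonAlgebra.quantumGroup 𝒢) (BichonAlgebra.q 𝒢) BichonAlgebra.q_rel
    BichonAlgebra.comul_q BichonAlgebra.dense_adjoin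

theorem coeff_universal_α (h𝒢 : 𝒢.IsSimple) :
    coeff (universal.{u} 𝒢 h𝒢).α = BichonAlgebra.q 𝒢 :=
  coeff_ofCoeff BichonAlgebra.q_rel.star_eq (fun v w u => BichonAlgebra.q_rel.row u v w)
    BichonAlgebra.q_rel.sum_row

/-- A morphism of compact quantum groups compatible with the coefficients of the actions on the
vertices is a morphism of the category. -/
def homOfCoeff (h𝒢 : 𝒢.IsSimple) {X Y : BicObj.{u} 𝒢} (F : X.G ⟶ Y.G)
    (hF : ∀ v w, F.hom (coeff Y.α v w) = coeff X.α v w) : X ⟶ Y where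
  f := F
  map_α a := by
    funext v
    have h1 : Y.α a v = ∑ w, a w • coeff Y.α v w := apply_eq_sum_coeff Y.α.toAlgHom.toLinearMap a v
    have h2 : X.α a v = ∑ w, a w • coeff X.α v w := apply_eq_sum_coeff X.α.toAlgHom.toLinearMap a v
    rw [idTensor, h1, h2, map_sum]
    exact Finset.sum_congr rfl fun w _ => by rw [map_smul, hF]
  map_lam ξ := by
    funext e
    rw [idTensor, apply_eq_sum_coeff, apply_eq_sum_coeff, map_sum]
    refine Finset.sum_congr rfl fun g _ => ?_
    -- The coefficients of λ are products of coefficients of α, so compatibility with α is enough.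
    rw [map_smul, coeff_lam _ h𝒢, coeff_lam _ h𝒢, map_mul, hF, hF]

/-- Existence: the coefficients of X solve the relations and have the same comultiplication formula
as the generators. Uniqueness: compatibility with α at δ_w prescribes the map on every generator. -/
theorem nonempty_unique_hom (h𝒢 : 𝒢.IsSimple) (X : BicObj.{u} 𝒢) :
    Nonempty (Unique (X ⟶ universal.{u} 𝒢 h𝒢)) := by
  obtain ⟨f, hf⟩ := BichonAlgebra.exists_hom X.bichonRelations
  have hX : ∀ v w, X.G.Δ (coeff X.α v w) = ∑ u, MinTensor.tmul (coeff X.α v u) (coeff X.α u w) :=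
    X.isAction.coassoc.comul_coeff
  have hΔ : (MinTensor.map f f).comp (BichonAlgebra.comul 𝒢) = X.G.Δ.comp f :=
    BichonAlgebra.hom_ext fun v w => by
      rw [StarAlgHom.comp_apply, StarAlgHom.comp_apply, BichonAlgebra.comul_q, hf, hX, map_sum]
      exact Finset.sum_congr rfl fun u _ => by rw [map_tmul, hf, hf]
  let F : X.G ⟶ (universal.{u} 𝒢 h𝒢).G := ⟨f, fun a => DFunLike.congr_fun hΔ a⟩
  have hF : ∀ v w, F.hom (coeff (universal.{u} 𝒢 h𝒢).α v w) = coeff X.α v w := fun v w =>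
    (congrArg F.hom (congrFun (congrFun (coeff_universal_α h𝒢) v) w)).trans (hf v w)
  refine ⟨{ default := homOfCoeff h𝒢 F hF, uniq := fun F' => ?_ }⟩
  refine Hom.ext (CompactQuantumGroup.Hom.ext (BichonAlgebra.hom_ext fun v w => ?_))
  have h := congrFun (F'.map_α (Pi.single w 1)) v
  exact (congrArg F'.f.hom (congrFun (congrFun (coeff_universal_α h𝒢) v) w)).symm.trans
    (h.trans (hf v w).symm)

theorem isTerminal_universal (h𝒢 : 𝒢.IsSimple) :
    Nonempty (Limits.IsTerminal (universal.{u} 𝒢 h𝒢)) :=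
  ⟨@Limits.IsTerminal.ofUnique _ _ _ fun X => (nonempty_unique_hom h𝒢 X).some⟩

variable (𝒢) in
/-- The forgetful functor to compact quantum groups. -/
def forget : BicObj.{u} 𝒢 ⥤ CompactQuantumGroup.{u} where
  obj X := X.G
  map F := F.f

end BicObj

end DirectedGraph

end

theorem mainTheorem7 {V : Type v} {E : Type w} [Fintype V] [DecidableEq V] [Fintype E]
    [DecidableEq E] (𝒢 : DirectedGraph V E) (h𝒢 : 𝒢.IsSimple) :
    (∃ X : DirectedGraph.BicObj.{u} 𝒢, Nonempty (CategoryTheory.Limits.IsTerminal X)) ∧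
    (∃ A : CompactQuantumGroup.{u}, 𝒢.IsBichonQuantumAut A) ∧
    ∀ (X : DirectedGraph.BicObj.{u} 𝒢) (A : CompactQuantumGroup.{u}),
      Nonempty (CategoryTheory.Limits.IsTerminal X) → 𝒢.IsBichonQuantumAut A →
        Nonempty (X.G ≅ A) := by
  obtain ⟨hT⟩ := DirectedGraph.BicObj.isTerminal_universal.{u} h𝒢
  refine ⟨⟨_, ⟨hT⟩⟩, ⟨_, DirectedGraph.BichonAlgebra.isBichonQuantumAut⟩, ?_⟩
  rintro X A ⟨hX⟩ hA
  obtain ⟨i⟩ := (DirectedGraph.BichonAlgebra.isBichonQuantumAut.{u} (𝒢 := 𝒢)).nonempty_iso hA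
  -- Forgetting the actions carries the isomorphism of terminal objects to one of quantum groups.
  exact ⟨(DirectedGraph.BicObj.forget 𝒢).mapIso (hX.uniqueUpToIso hT) ≪≫ i⟩
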